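/- Let $m,n,N,q$ be integers with $m,q\ge 0$ and $1\le n\le N\le \frac32 n$. Let $H_1,\dots,H_q$ be hyperplanes in $\mathbb{P}^n(\mathbb{C})$ in general position and $H'_1,\dots,H'_q$ hyperplanes in $\mathbb{P}^N(\mathbb{C})$ in general position (that is, any at most $n+1$, respectively at most $N+1$, of them have linearly independent defining linear forms). Let $f:\mathbb{C}^m\to\mathbb{P}^n(\mathbb{C})$ and $g:\mathbb{C}^m\to\mathbb{P}^N(\mathbb{C})$ be meromorphic maps such that, for every $1\le j\le q$, $f(\mathbb{C}^m)\not\subseteq H_j$, $g(\mathbb{C}^m)\not\subseteq H'_j$, and the pullback divisors agree: $f^*(H_j)=g^*(H'_j)$. (i) If $g$ is linearly non-degenerate (its image lies in no hyperplane of $\mathbb{P}^N(\mathbb{C})$) and $q\ge 3n+2$, then $N=n$ and there are a projective linear transformation $L$ of $\mathbb{P}^n(\mathbb{C})$ and $n+2$ distinct indices $k_1,\dots,k_{n+2}\in\{1,\dots,q\}$ such that $f=L(g)$ and $L(H'_{k_i})=H_{k_i}$ for $1\le i\le n+2$. (ii) If $g(\mathbb{C}^m)$ is not contained in any hypersurface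 of degree $\le N-n+2$ in $\mathbb{P}^N(\mathbb{C})$ and $q\ge 3n+1$, then $N=n$ and there is a projective linear transformation $L$ of $\mathbb{P}^n(\mathbb{C})$ such that $f=L(g)$ and either \[ L(H'_{k_i})=H_{k_i},\quad 1\le i\le n+2, \] for some $n+2$ distinct indices $k_1,\dots,k_{n+2}\in\{1,\dots,q\}$, or \[ L(H'_{k_i})=H_{k_i},\ 1\le i\le n+1,\quad L(H'_{k_{n+2}})=H_{k_{n+3}},\quad L(H'_{k_{n+3}})=H_{k_{n+2}}, \] for some $n+3$ distinct indices $k_1,\dots,k_{n+3}\in\{1,\dots,q\}$. -/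

import Mathlib

open Filter Topology
open scoped LinearAlgebra.Projectivization

namespace HyperplaneSharing

/-- The `n`-dimensional complex projective space, with homogeneous coordinates indexed by
`0, …, n`. -/
abbrev PSpace (n : ℕ) : Type := ℙ ℂ (Fin (n + 1) → ℂ)

/-- `F` is a reduced representation, near `z`, of the map `φ` defined off the set `I`: it is a
tuple of functions holomorphic at `z` whose common zeros near `z` are the points of `I` and
which, near `z`, gives homogeneous coordinates of `φ` off `I`. -/
def IsReducedRepAt {m n : ℕ} (I : Set (Fin m → ℂ)) (φ : ∀ z : Fin m → ℂ, z ∉ I → PSpace n)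
    (z : Fin m → ℂ) (F : (Fin m → ℂ) → Fin (n + 1) → ℂ) : Prop :=
  AnalyticAt ℂ F z ∧
    ∀ᶠ w in 𝓝 z, (w ∈ I ↔ F w = 0) ∧
      ∀ (hw : w ∉ I) (h0 : F w ≠ 0), φ w hw = Projectivization.mk ℂ (F w) h0

/-- The (analytic) set `I` has codimension at least two in `ℂ ^ m`: through each point `p` of `I`
there is a complex affine plane in which `p` is an isolated point of `I`. In particular `I` is
empty if `m ≤ 1`. -/
def CodimAtLeastTwo {m : ℕ} (I : Set (Fin m → ℂ)) : Prop :=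
  ∀ p ∈ I, ∃ a b : Fin m → ℂ, LinearIndependent ℂ ![a, b] ∧
    ∀ᶠ t : ℂ × ℂ in 𝓝 0, p + t.1 • a + t.2 • b ∈ I → t = 0

/-- A meromorphic map of `ℂ ^ m` into the `n`-dimensional projective space: a map defined off its
indeterminacy locus, which has codimension at least two, and having near every point of `ℂ ^ m`
a reduced representation. -/
structure MeromorphicMap (m n : ℕ) where
  /-- the indeterminacy locus -/
  indet : Set (Fin m → ℂ)
  /-- the values off the indeterminacy locus -/
  toFun : ∀ z : Fin m → ℂ, z ∉ indet → PSpace n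
  codim_indet : CodimAtLeastTwo indet
  exists_reducedRep : ∀ z, ∃ F, IsReducedRepAt indet toFun z F

/-- The image of a meromorphic map. -/
def MeromorphicMap.image {m n : ℕ} (f : MeromorphicMap m n) : Set (PSpace n) :=
  {x | ∃ (z : Fin m → ℂ) (hz : z ∉ f.indet), f.toFun z hz = x}

/-- The map of projective spaces induced by an invertible linear map. -/
noncomputable def projMap {N n : ℕ} (L : (Fin (N + 1) → ℂ) ≃ₗ[ℂ] (Fin (n + 1) → ℂ)) : PSpace N → PSpace n :=
  Projectivization.map L.toLinearMap L.injective

/-- The composition `L(g)` of a meromorphic map with the projective linear map given by `L`. -/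
noncomputable def MeromorphicMap.comp {m N n : ℕ} (L : (Fin (N + 1) → ℂ) ≃ₗ[ℂ] (Fin (n + 1) → ℂ))
    (g : MeromorphicMap m N) : MeromorphicMap m n where
  indet := g.indet
  toFun z hz := projMap L (g.toFun z hz)
  codim_indet := g.codim_indet
  exists_reducedRep z := by
    obtain ⟨G, hG, hev⟩ := g.exists_reducedRep z
    refine ⟨fun w => L (G w), ?_, ?_⟩
    · exact ((LinearMap.toContinuousLinearMap L.toLinearMap).analyticAt (G z)).comp hG
    · filter_upwards [hev] with w hw
      refine ⟨by simpa using hw.1, fun hwI h0 => ?_⟩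
      have h1 : G w ≠ 0 := fun h => h0 (by simp [h])
      simp only [projMap]
      rw [hw.2 hwI h1, Projectivization.map_mk]
      rfl

/-- Hyperplanes of the `n`-dimensional projective space, as points of the dual projective space,
that is, as nonzero linear forms up to nonzero scalars. -/
abbrev Hyperplane (n : ℕ) : Type := ℙ ℂ (Module.Dual ℂ (Fin (n + 1) → ℂ))

/-- A linear form that defines the hyperplane `H`. -/
noncomputable def Hyperplane.form {n : ℕ} (H : Hyperplane n) : Module.Dual ℂ (Fin (n + 1) → ℂ) :=
  Projectivization.rep H

/-- The set of points of the hyperplane `H`. -/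
def Hyperplane.points {n : ℕ} (H : Hyperplane n) : Set (PSpace n) :=
  {x | Hyperplane.form H x.rep = 0}

/-- Hyperplanes in general position: any at most `n + 1` of them have linearly independent
defining linear forms. -/
def InGeneralPosition {n q : ℕ} (H : Fin q → Hyperplane n) : Prop :=
  ∀ s : Finset (Fin q), s.card ≤ n + 1 →
    LinearIndependent ℂ (fun i : s => Hyperplane.form (H i))

/-- The pullback divisor `f^*H`, for a meromorphic map `f` whose image is not contained in `H`, as
an effective Cartier divisor: to each point `z` it assigns the set of its local equations at `z`,
which are the functions equal, near `z`, to `u * (f, H)`, where `u` is holomorphic at `z` with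
`u z ≠ 0` and `(f, H)` is the composition of a linear form defining `H` with a reduced
representation of `f` near `z`. -/
def MeromorphicMap.pullbackDivisor {m n : ℕ} (f : MeromorphicMap m n) (H : Hyperplane n) :
    (Fin m → ℂ) → Set ((Fin m → ℂ) → ℂ) :=
  fun z => {e | ∃ (F : (Fin m → ℂ) → Fin (n + 1) → ℂ) (u : (Fin m → ℂ) → ℂ),
    IsReducedRepAt f.indet f.toFun z F ∧ AnalyticAt ℂ u z ∧ u z ≠ 0 ∧
      ∀ᶠ w in 𝓝 z, e w = u w * Hyperplane.form H (F w)}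

/-- A meromorphic map is linearly non-degenerate if its image lies in no hyperplane. -/
def MeromorphicMap.LinearlyNondegenerate {m n : ℕ} (f : MeromorphicMap m n) : Prop :=
  ∀ H : Hyperplane n, ¬ f.image ⊆ Hyperplane.points H

/-- The zero set in projective space of a homogeneous polynomial. -/
def projZeros {n : ℕ} (P : MvPolynomial (Fin (n + 1)) ℂ) : Set (PSpace n) :=
  {x | MvPolynomial.eval x.rep P = 0}

/-- The image of the meromorphic map `f` lies in no hypersurface of degree at most `D`. -/
def MeromorphicMap.InNoHypersurfaceOfDegreeLE {m n : ℕ} (f : MeromorphicMap m n) (D : ℕ) : Prop :=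
  ∀ d : ℕ, 1 ≤ d → d ≤ D → ∀ P : MvPolynomial (Fin (n + 1)) ℂ,
    P.IsHomogeneous d → P ≠ 0 → ¬ f.image ⊆ projZeros P

end HyperplaneSharing

/-! Equality of the divisors makes the quotients of `(f, H j)` by `(g, H' j)` zero-free, so in
suitable homogeneous coordinates `x`, `y` of the values of `f` and `g` one has `H j (x) = h j * H' j
(y)` with zero-free entire functions `h j`. For any `n + N + 2` indices these equations form a
square homogeneous linear system in `(x, y)` with a nonzero solution. Its determinant therefore
vanishes, and expanding it gives a relation `∑ c I * ∏ j ∈ I, h j = 0` over the `(N + 1)`-element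
subsets `I`, with all `c I ≠ 0` by general position (`exists_elimination`).

Borel's theorem (`exists_sub_const_of_sum_exp_eq_zero`) says that each product in this relation is a
constant multiple of another one. On a generic complex line the logarithms of the `h j`, modulo
constants, are sent by a generic real linear functional to real weights `p j` (`exists_weights`).
Every `(N + 1)`-subset of an `(n + N + 2)`-set of indices then shares its sum of weights with a
different one. Sorting the weights shows that all of them coincide except possibly the `n` lowest
and the `n` highest; this is where `2 * N ≤ 3 * n` enters.

If `q ≥ 3n + 2`, some `n + 2` units are proportional. Any `n + 1` of them determine a linear map `A`
with `f = A(g)`, and nondegeneracy of `g` makes `A` match the last hyperplane too. If `N > n`, this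
would produce `n + 2` independent forms out of an `(n + 1)`-dimensional dual space; hence `N = n`,
and `A` is invertible.

If `q = 3n + 1` and only `n + 1` weights equal the middle value `s`, two further indices `a`, `b`
satisfy `p a + p b = 2 * s` or `p a = p b` (`HasExchangeProperty.exists_opposite`). Either relation
is a quadratic identity along `g`, hence an identity of polynomials. Unique factorisation into
linear forms turns the first into the transposition of two hyperplanes and rules out the second.

Borel's theorem is itself proved through a generalised Wronskian, Cramer's rule and Jensen's
inequality. Circle averages of `|Re ψ|` serve as the characteristic function, and Cauchy's estimates
replace the lemma on the logarithmic derivative. -/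

namespace HyperplaneSharing

/-! ### Growth of entire functions of one variable in terms of circle averages. -/

section OneVariable

open Real Complex Metric Set

/-- The `n`-th Taylor coefficient of an entire function is controlled by the circle averages of the
absolute value of its real part. -/
theorem taylorCoeff_mul_pow_le {ψ : ℂ → ℂ} (hψ : Differentiable ℂ ψ) {n : ℕ} (hn : n ≠ 0)
    {r : ℝ} (hr : 0 < r) :
    ‖(n.factorial : ℂ)⁻¹ * iteratedDeriv n ψ 0‖ * r ^ n
      ≤ 2 * circleAverage (fun z => |(ψ z).re|) 0 r := by
  have hne : ∀ z ∈ sphere (0 : ℂ) |r|, z ≠ 0 := by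
    intro z hz h
    rw [h, abs_of_pos hr] at hz
    simp only [mem_sphere_iff_norm, sub_self, norm_zero] at hz
    exact hr.ne hz
  have hci : ∀ {g : ℂ → ℂ}, ContinuousOn g (sphere (0 : ℂ) |r|) → CircleIntegrable g 0 r :=
    fun h => h.circleIntegrable'
  have hcont : Continuous ψ := hψ.continuous
  have h1 : circleAverage (fun z => (z ^ n)⁻¹ * ψ z) 0 r
      = (n.factorial : ℂ)⁻¹ * iteratedDeriv n ψ 0 := by
    rw [circleAverage_eq_circleIntegral hr.ne']
    have := (hψ.diffContOnCl (s := ball 0 r)).circleIntegral_one_div_sub_center_pow_smul hr n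
    have h2 : (∮ z in C(0, r), (z - 0)⁻¹ • ((z ^ n)⁻¹ * ψ z))
        = (2 * π * I / n.factorial) • iteratedDeriv n ψ 0 := by
      rw [← this]
      apply circleIntegral.integral_congr hr.le
      intro z hz
      simp [pow_succ, mul_comm]
      ring
    rw [h2, smul_smul, smul_eq_mul]
    congr 1
    field_simp [Real.pi_ne_zero, Complex.I_ne_zero]
  have h2 : circleAverage (fun z => z ^ n * ψ z) 0 r = 0 := by
    have : Differentiable ℂ (fun z : ℂ => z ^ n * ψ z) := by fun_prop
    rw [(this.diffContOnCl (s := ball 0 |r|)).circleAverage]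
    simp [hn]
  have hc : CircleIntegrable (fun z => z ^ n * ψ z) 0 r :=
    hci (by fun_prop)
  have h3 : circleAverage (fun z => (starRingEnd ℂ) (z ^ n * ψ z)) 0 r = 0 := by
    have := (Complex.conjCLE : ℂ →L[ℝ] ℂ).circleAverage_comp_comm hc
    rw [h2, map_zero] at this
    exact this
  -- On the circle `z⁻ⁿ * conj ψ = r⁻²ⁿ * conj (zⁿ * ψ)`, and `zⁿ * ψ` has mean value zero. Adding
  -- this vanishing average replaces `ψ` by `2 * Re ψ` in the coefficient formula.
  have h4 : circleAverage (fun z => (z ^ n)⁻¹ * (starRingEnd ℂ) (ψ z)) 0 r = 0 := by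
    have : circleAverage (fun z => (z ^ n)⁻¹ * (starRingEnd ℂ) (ψ z)) 0 r
        = circleAverage (fun z => ((r : ℂ) ^ (2 * n))⁻¹ • (starRingEnd ℂ) (z ^ n * ψ z)) 0 r := by
      apply circleAverage_congr_sphere
      intro z hz
      have hz0 := hne z hz
      have hz1 : (starRingEnd ℂ) z * z = (r : ℂ) ^ 2 := by
        rw [mul_comm, Complex.mul_conj, Complex.normSq_eq_norm_sq]
        have : ‖z‖ = r := by simpa [abs_of_pos hr] using hz
        rw [this]; push_cast; rfl
      have hr0 : (r : ℂ) ≠ 0 := by exact_mod_cast hr.ne'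
      simp only [map_mul, map_pow, smul_eq_mul]
      rw [pow_mul, ← hz1, mul_pow]
      have : (starRingEnd ℂ) z ≠ 0 := by simpa using hz0
      field_simp
    rw [this, circleAverage_fun_smul, h3, smul_zero]
  have hinv : ContinuousOn (fun z : ℂ => (z ^ n)⁻¹) (sphere (0 : ℂ) |r|) :=
    ContinuousOn.inv₀ (by fun_prop) (fun z hz => pow_ne_zero _ (hne z hz))
  have h5 : (n.factorial : ℂ)⁻¹ * iteratedDeriv n ψ 0
      = circleAverage (fun z => (z ^ n)⁻¹ * ((2 * (ψ z).re : ℝ) : ℂ)) 0 r := by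
    have h := circleAverage_fun_add (f₁ := fun z => (z ^ n)⁻¹ * ψ z)
      (f₂ := fun z => (z ^ n)⁻¹ * (starRingEnd ℂ) (ψ z)) (hci (hinv.mul hcont.continuousOn))
      (hci (hinv.mul (Complex.continuous_conj.comp hcont).continuousOn))
    rw [h1, h4, add_zero] at h
    rw [← h]
    congr 1
    ext z
    rw [← mul_add, Complex.add_conj]
  rw [h5, circleAverage_def, norm_smul]
  have h6 : ‖∫ θ in (0 : ℝ)..2 * π, ((circleMap 0 r θ) ^ n)⁻¹ *
        ((2 * (ψ (circleMap 0 r θ)).re : ℝ) : ℂ)‖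
      ≤ ∫ θ in (0 : ℝ)..2 * π, (r ^ n)⁻¹ * (2 * |(ψ (circleMap 0 r θ)).re|) := by
    refine (intervalIntegral.norm_integral_le_integral_norm two_pi_pos.le).trans_eq ?_
    apply intervalIntegral.integral_congr
    intro θ _
    simp [abs_of_pos hr]
  have h7 : ∫ θ in (0 : ℝ)..2 * π, (r ^ n)⁻¹ * (2 * |(ψ (circleMap 0 r θ)).re|)
      = (r ^ n)⁻¹ * (2 * ∫ θ in (0 : ℝ)..2 * π, |(ψ (circleMap 0 r θ)).re|) := by
    simp
  rw [h7] at h6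
  rw [circleAverage_def, smul_eq_mul]
  have hp : 0 < (2 * π)⁻¹ := inv_pos.2 two_pi_pos
  calc _ ≤ ‖(2 * π)⁻¹‖ * ((r ^ n)⁻¹ * (2 * ∫ θ in (0 : ℝ)..2 * π, |(ψ (circleMap 0 r θ)).re|))
        * r ^ n := by gcongr
    _ = _ := by
      rw [Real.norm_of_nonneg hp.le]
      have : r ^ n ≠ 0 := by positivity
      field_simp

/-- Growth of an entire function in terms of the circle averages of its real part. -/
theorem norm_sub_le_circleAverage {ψ : ℂ → ℂ} (hψ : Differentiable ℂ ψ) {ρ r : ℝ} (hρ : 0 ≤ ρ)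
    (hr : ρ < r) {z : ℂ} (hz : ‖z‖ ≤ ρ) :
    ‖ψ z - ψ 0‖ ≤ 2 * circleAverage (fun z => |(ψ z).re|) 0 r * (r / (r - ρ)) := by
  have hr0 : 0 < r := hρ.trans_lt hr
  set A := circleAverage (fun z => |(ψ z).re|) 0 r
  have hA : 0 ≤ A := circleAverage_nonneg_of_nonneg (fun _ _ => abs_nonneg _)
  have hs := hasSum_taylorSeries_of_entire hψ 0 z
  have hs' := (hasSum_nat_add_iff' 1).2 hs
  simp only [Finset.range_one, Finset.sum_singleton, Nat.factorial_zero, Nat.cast_one, inv_one,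
    pow_zero, iteratedDeriv_zero, one_smul] at hs'
  rw [← hs'.tsum_eq]
  have hq : ρ / r < 1 := (div_lt_one hr0).2 hr
  have hq0 : 0 ≤ ρ / r := by positivity
  have hg : HasSum (fun n : ℕ => 2 * A * (ρ / r) ^ n) (2 * A * (r / (r - ρ))) := by
    have := (hasSum_geometric_of_lt_one hq0 hq).mul_left (2 * A)
    have h' : 1 - ρ / r = (r - ρ) / r := by field_simp
    rwa [h', inv_div] at this
  refine tsum_of_norm_bounded hg fun n => ?_
  have h1 := taylorCoeff_mul_pow_le hψ (Nat.succ_ne_zero n) hr0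
  have h2 : ‖z‖ ^ (n + 1) ≤ (ρ / r) ^ n * r ^ (n + 1) := by
    calc ‖z‖ ^ (n + 1) ≤ ρ ^ (n + 1) := by gcongr
      _ ≤ ρ ^ n * r := by rw [pow_succ]; gcongr
      _ = _ := by rw [div_pow, pow_succ]; field_simp
  calc _ = ‖((n + 1).factorial : ℂ)⁻¹ * iteratedDeriv (n + 1) ψ 0‖ * ‖z‖ ^ (n + 1) := by
        simp only [norm_smul, norm_pow, norm_mul, sub_zero]; ring
    _ ≤ ‖((n + 1).factorial : ℂ)⁻¹ * iteratedDeriv (n + 1) ψ 0‖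
        * ((ρ / r) ^ n * r ^ (n + 1)) := by gcongr
    _ = (‖((n + 1).factorial : ℂ)⁻¹ * iteratedDeriv (n + 1) ψ 0‖ * r ^ (n + 1)) * (ρ / r) ^ n := by
        ring
    _ ≤ _ := by gcongr

/-- Growth on the disc of radius `r + δ / 2` and Cauchy's estimate on discs of radius `δ / 4` bound
`ψ'` by `16 * A * (r + δ) / δ ^ 2` near `z`; the mean value inequality then gives oscillation at
most one on a disc of the reciprocal radius. -/
theorem norm_sub_le_of_circleAverage_le {ψ : ℂ → ℂ} (hψ : Differentiable ℂ ψ) {r δ A : ℝ}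
    (hr : 0 ≤ r) (hδ : 0 < δ) (hA0 : 0 < A) (hA : circleAverage (fun z => |(ψ z).re|) 0 (r + δ) ≤ A)
    {z w : ℂ} (hz : ‖z‖ ≤ r) (hw : ‖w - z‖ ≤ min (δ / 4) (δ ^ 2 / (16 * A * (r + δ)))) :
    ‖ψ w - ψ z‖ ≤ 1 := by
  have hw1 : ‖w - z‖ ≤ δ / 4 := hw.trans (min_le_left _ _)
  have hw2 : ‖w - z‖ ≤ δ ^ 2 / (16 * A * (r + δ)) := hw.trans (min_le_right _ _)
  set K := 4 * A * (r + δ) / δ with hK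
  have hd : ∀ x ∈ closedBall z (δ / 4), ‖deriv ψ x‖ ≤ K / (δ / 4) := by
    intro x hx
    have hx' : ‖x - z‖ ≤ δ / 4 := by simpa [dist_eq_norm] using hx
    have h1 : deriv ψ x = deriv (fun y => ψ y - ψ 0) x := by simp
    rw [h1]
    refine norm_deriv_le_of_forall_mem_sphere_norm_le (by positivity)
      (hψ.sub_const _).diffContOnCl ?_
    intro y hy
    have hy' : ‖y - x‖ = δ / 4 := by simpa [dist_eq_norm] using hy
    have hy2 : ‖y‖ ≤ r + δ / 2 := by
      calc ‖y‖ = ‖(y - x) + (x - z) + z‖ := by ring_nf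
        _ ≤ ‖y - x‖ + ‖x - z‖ + ‖z‖ := norm_add₃_le
        _ ≤ _ := by linarith
    refine (norm_sub_le_circleAverage hψ (by positivity) (by linarith : r + δ / 2 < r + δ)
      hy2).trans ?_
    have : (r + δ) / (r + δ - (r + δ / 2)) = 2 * (r + δ) / δ := by
      have : r + δ - (r + δ / 2) = δ / 2 := by ring
      rw [this]; field_simp
    rw [this, hK]
    calc _ ≤ 2 * A * (2 * (r + δ) / δ) := by gcongr
      _ = _ := by ring
  have h1 := (convex_closedBall z (δ / 4)).norm_image_sub_le_of_norm_deriv_le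
    (fun x _ => hψ x) hd (mem_closedBall_self (by positivity))
    (by simpa [dist_eq_norm] using hw1 : w ∈ closedBall z (δ / 4))
  refine h1.trans ?_
  calc _ ≤ K / (δ / 4) * (δ ^ 2 / (16 * A * (r + δ))) := by
        gcongr
    _ = 1 := by
      rw [hK]
      have : r + δ ≠ 0 := by positivity
      field_simp
      ring

/-- The inequality part of Jensen's formula. -/
theorem log_norm_le_circleAverage {W : ℂ → ℂ} (hW : Differentiable ℂ W) (h0 : W 0 ≠ 0) {r : ℝ}
    (hr : 0 < r) : Real.log ‖W 0‖ ≤ circleAverage (fun z => Real.log ‖W z‖) 0 r := by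
  have ha : AnalyticOnNhd ℂ W (closedBall 0 |r|) := fun z _ => hW.analyticAt z
  rw [ha.circleAverage_log_norm hr.ne' h0]
  refine le_add_of_nonneg_left (finsum_nonneg fun u => ?_)
  by_cases hu : u ∈ closedBall (0 : ℂ) |r|
  · refine mul_nonneg ?_ ?_
    · have := (MeromorphicOn.AnalyticOnNhd.divisor_nonneg ha) u
      exact_mod_cast this
    · rcases eq_or_ne u 0 with rfl | hu0
      · simp
      · apply Real.log_nonneg
        rw [zero_sub, norm_neg, ← div_eq_mul_inv, le_div_iff₀ (norm_pos_iff.2 hu0), one_mul]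
        simpa [abs_of_pos hr] using hu
  · simp [Function.locallyFinsuppWithin.apply_eq_zero_of_notMem _ hu]

/-- Off the zeros of `W`, `log |W| + (Re ψ)⁺ = max (log |W|) (log |m|) ≤ log K` on the circle.
Jensen's inequality bounds the average of `log |W|` below, hence that of `(Re ψ)⁺` above, and `|Re
ψ| = 2 * (Re ψ)⁺ - Re ψ`, where `Re ψ` has average `Re (ψ 0)`. -/
theorem circleAverage_abs_re_le {W m ψ : ℂ → ℂ} (hW : Differentiable ℂ W) (hψ : Differentiable ℂ ψ)
    (h0 : W 0 ≠ 0) (hm : ∀ z, W z * Complex.exp (ψ z) = m z) {r K : ℝ} (hr : 0 < r)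
    (hWK : ∀ z ∈ sphere (0 : ℂ) r, ‖W z‖ ≤ K) (hmK : ∀ z ∈ sphere (0 : ℂ) r, ‖m z‖ ≤ K) :
    circleAverage (fun z => |(ψ z).re|) 0 r
      ≤ 2 * Real.log K - 2 * Real.log ‖W 0‖ - (ψ 0).re := by
  classical
  have hcont : Continuous ψ := hψ.continuous
  have ha : AnalyticOnNhd ℂ W univ := fun z _ => hW.analyticAt z
  have hcod : ∀ᶠ z in codiscreteWithin (sphere (0 : ℂ) |r|), W z ≠ 0 := by
    have h1 : W ⁻¹' {0}ᶜ ∈ codiscrete ℂ := ha.preimage_zero_mem_codiscrete h0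
    exact codiscreteWithin_mono (subset_univ _) h1
  have hi1 : CircleIntegrable (fun z => Real.log ‖W z‖) 0 r :=
    MeromorphicOn.circleIntegrable_log_norm fun z _ => (hW.analyticAt z).meromorphicAt
  have hi2 : CircleIntegrable (fun z => max (ψ z).re 0) 0 r :=
    Continuous.continuousOn (by fun_prop) |>.circleIntegrable'
  have hi3 : CircleIntegrable (fun z => (ψ z).re) 0 r :=
    Continuous.continuousOn (by fun_prop) |>.circleIntegrable'
  set f₁ : ℂ → ℝ := fun z => Real.log ‖W z‖ + max (ψ z).re 0
  -- Since `Real.log 0 = 0`, the bound by `log K` may fail at the zeros of `W`. Changing the values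
  -- on this discrete set does not affect the average.
  set f₂ : ℂ → ℝ := fun z => if W z = 0 then Real.log K else f₁ z
  have h12 : f₁ =ᶠ[codiscreteWithin (sphere (0 : ℂ) |r|)] f₂ := by
    filter_upwards [hcod] with z hz
    simp [f₂, hz]
  have hle : circleAverage f₂ 0 r ≤ Real.log K := by
    refine circleAverage_mono_on_of_le_circle ((hi1.add hi2).congr_codiscreteWithin h12) ?_
    intro z hz
    rw [abs_of_pos hr] at hz
    by_cases hz0 : W z = 0
    · simp [f₂, hz0]
    · simp only [f₂, hz0, if_false, f₁]
      have hpos : 0 < ‖W z‖ := norm_pos_iff.2 hz0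
      rcases le_total (ψ z).re 0 with h | h
      · rw [max_eq_right h, add_zero]
        exact Real.log_le_log hpos (hWK z hz)
      · rw [max_eq_left h, ← Real.log_exp (ψ z).re, ← Complex.norm_exp,
          ← Real.log_mul hpos.ne' (norm_ne_zero_iff.2 (Complex.exp_ne_zero _)), ← norm_mul, hm]
        refine Real.log_le_log ?_ (hmK z hz)
        rw [← hm, norm_mul]
        exact mul_pos hpos (norm_pos_iff.2 (Complex.exp_ne_zero _))
  rw [← circleAverage_congr_codiscreteWithin h12 hr.ne', circleAverage_fun_add hi1 hi2] at hle
  have hJ := log_norm_le_circleAverage hW h0 hr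
  have hre : circleAverage (fun z => (ψ z).re) 0 r = (ψ 0).re := by
    have h1 := Complex.reCLM.circleAverage_comp_comm (c := 0) (R := r) (f := ψ)
      (hψ.continuous.continuousOn.circleIntegrable')
    rw [(hψ.diffContOnCl (s := ball 0 |r|)).circleAverage] at h1
    exact h1
  have habs : (fun z => |(ψ z).re|) = fun z => ((2 : ℝ) • max (ψ z).re 0) - (ψ z).re := by
    ext z
    rcases le_total (ψ z).re 0 with h | h
    · simp [h, abs_of_nonpos h]
    · simp [h, abs_of_nonneg h]; ring
  have h2 : circleAverage (fun z => |(ψ z).re|) 0 r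
      = 2 * circleAverage (fun z => max (ψ z).re 0) 0 r - (ψ 0).re := by
    rw [habs, ← hre, ← smul_eq_mul, ← circleAverage_fun_smul]
    exact circleAverage_fun_sub (hi2.const_smul (a := (2 : ℝ))) hi3
  linarith

/-- Borel's growth lemma. -/
theorem exists_growth_le {M : ℝ → ℝ} (hM : Continuous M) (h1 : ∀ r, 1 ≤ M r) (R : ℝ) :
    ∃ r, R ≤ r ∧ M (r + 1 / M r) ≤ 2 * M r := by
  by_contra! hcon
  -- If the claim fails beyond `R`, each step of this sequence at least doubles `M`, while the step
  -- lengths are at most `2⁻ᵏ`. So `M` would be unbounded on `[R, R + 2]`.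
  let u : ℕ → ℝ := fun k => Nat.rec R (fun _ x => x + 1 / M x) k
  have hu : ∀ k, u (k + 1) = u k + 1 / M (u k) := fun k => rfl
  have h0 : u 0 = R := rfl
  have key : ∀ k, R ≤ u k ∧ u k ≤ R + 2 - 2 * (1 / 2) ^ k ∧ 2 ^ k ≤ M (u k) := by
    intro k
    induction k with
    | zero => simp [h0, h1]
    | succ k ih =>
      obtain ⟨a, b, c⟩ := ih
      have hp : 0 < M (u k) := zero_lt_one.trans_le (h1 _)
      have hd : 1 / M (u k) ≤ (1 / 2) ^ k := by
        rw [one_div, one_div, inv_pow]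
        exact inv_anti₀ (by positivity) c
      refine ⟨?_, ?_, ?_⟩
      · rw [hu]; have : 0 < 1 / M (u k) := by positivity
        linarith
      · rw [hu, pow_succ]; linarith
      · rw [hu, pow_succ]; have := hcon (u k) a; linarith
  obtain ⟨C, hC⟩ := (isCompact_Icc (a := R) (b := R + 2)).bddAbove_image hM.continuousOn
  obtain ⟨k, hk⟩ := pow_unbounded_of_one_lt C (one_lt_two)
  obtain ⟨a, b, c⟩ := key k
  have : M (u k) ≤ C := hC ⟨u k, ⟨a, by
    have : (0 : ℝ) < (1 / 2) ^ k := by positivity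
    linarith⟩, rfl⟩
  linarith

end OneVariable

end HyperplaneSharing

namespace HyperplaneSharing

/-! ### Borel's theorem on sums of exponentials of entire functions. -/

section Borel

open Real Complex Metric Set

theorem eq_zero_of_mul_le_log {x a b : ℝ} (hx : 0 ≤ x)
    (h : ∀ R : ℝ, ∃ r, R ≤ r ∧ x * r ≤ a + b * Real.log r) : x = 0 := by
  by_contra hne
  have hpos : 0 < x := lt_of_le_of_ne hx (Ne.symm hne)
  have h1 : (fun r : ℝ => a + b * Real.log r) =o[atTop] (fun r : ℝ => r) := by
    refine Asymptotics.IsLittleO.add ?_ (Real.isLittleO_log_id_atTop.const_mul_left b)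
    exact Asymptotics.isLittleO_const_left.2 (Or.inr tendsto_norm_atTop_atTop)
  have h2 := h1.bound (half_pos hpos)
  obtain ⟨R, hR⟩ := eventually_atTop.1 (h2.and (eventually_gt_atTop 0))
  obtain ⟨r, hr, hle⟩ := h R
  obtain ⟨h3, h4⟩ := hR r hr
  rw [Real.norm_eq_abs, Real.norm_of_nonneg h4.le] at h3
  have := le_abs_self (a + b * Real.log r)
  nlinarith

/-- Linearly independent entire functions have a nonsingular square matrix of derivatives. -/
theorem exists_det_iteratedDeriv_ne_zero {ι : Type*} [Fintype ι] [DecidableEq ι] {g : ι → ℂ → ℂ}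
    (hg : ∀ i, Differentiable ℂ (g i)) (hli : LinearIndependent ℂ g) :
    ∃ n : ι → ℕ, (Matrix.of fun j i => iteratedDeriv (n j) (g i) 0).det ≠ 0 := by
  let v : ℕ → ι → ℂ := fun k i => iteratedDeriv k (g i) 0
  -- A linear functional killing all vectors of derivatives at `0` would give a linear relation
  -- between the Taylor series, hence between the functions.
  have htop : Submodule.span ℂ (range v) = ⊤ := by
    by_contra hne
    obtain ⟨f, hf0, hf⟩ := Submodule.exists_le_ker_of_lt_top _ (lt_top_iff_ne_top.2 hne)
    have hfv : ∀ x : ι → ℂ, f x = ∑ i, x i * f (Pi.single i 1) := by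
      intro x
      conv_lhs => rw [pi_eq_sum_univ' x]
      rw [map_sum]
      refine Finset.sum_congr rfl fun i _ => ?_
      rw [map_smul, smul_eq_mul]
    have hzero : ∑ i, f (Pi.single i 1) • g i = 0 := by
      ext z
      have hs : HasSum (fun n : ℕ => ∑ i, f (Pi.single i 1) *
          ((n.factorial : ℂ)⁻¹ • (z - 0) ^ n • iteratedDeriv n (g i) 0))
          (∑ i, f (Pi.single i 1) * g i z) :=
        hasSum_sum fun i _ => (hasSum_taylorSeries_of_entire (hg i) 0 z).mul_left _
      have hz : (fun n : ℕ => ∑ i, f (Pi.single i 1) *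
          ((n.factorial : ℂ)⁻¹ • (z - 0) ^ n • iteratedDeriv n (g i) 0)) = fun _ => 0 := by
        ext n
        have h1 : f (v n) = 0 := hf (Submodule.subset_span ⟨n, rfl⟩)
        rw [hfv] at h1
        calc _ = (n.factorial : ℂ)⁻¹ * (z - 0) ^ n * ∑ i, v n i * f (Pi.single i 1) := by
              rw [Finset.mul_sum]
              refine Finset.sum_congr rfl fun i _ => ?_
              simp only [smul_eq_mul, v]
              ring
          _ = 0 := by rw [h1, mul_zero]
      rw [hz] at hs
      simpa [Finset.sum_apply] using (hasSum_zero.unique hs).symm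
    have hc := Fintype.linearIndependent_iff.1 hli _ hzero
    apply hf0
    ext x
    simp [hc]
  obtain ⟨κ, a, -, hsp, hla⟩ := exists_linearIndependent' ℂ v
  rw [htop] at hsp
  let B := Module.Basis.mk hla hsp.ge
  let e : κ ≃ ι := B.indexEquiv (Pi.basisFun ℂ ι)
  refine ⟨a ∘ e.symm, ?_⟩
  have h1 : LinearIndependent ℂ (v ∘ (a ∘ e.symm)) := hla.comp _ e.symm.injective
  have h2 : LinearIndependent ℂ
      (Matrix.of fun j i => iteratedDeriv ((a ∘ e.symm) j) (g i) 0).row := h1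
  rw [Matrix.linearIndependent_rows_iff_isUnit, Matrix.isUnit_iff_isUnit_det] at h2
  exact h2.ne_zero

/-- On the disc of radius `ε`, `exp ψ` is at most `e` times its modulus at the centre, so Cauchy's
estimate bounds the derivatives relative to that modulus. This plays the role of the lemma on the
logarithmic derivative. -/
theorem norm_iteratedDeriv_exp_le {ψ : ℂ → ℂ} (hψ : Differentiable ℂ ψ) {ε : ℝ} (hε : 0 < ε)
    (hε1 : ε ≤ 1) {z : ℂ} (h : ∀ w, ‖w - z‖ ≤ ε → ‖ψ w - ψ z‖ ≤ 1) {n D : ℕ} (hn : n ≤ D) :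
    ‖iteratedDeriv n (fun w => Complex.exp (ψ w)) z * Complex.exp (-ψ z)‖
      ≤ D.factorial * Real.exp 1 * (1 / ε) ^ D := by
  have hd : Differentiable ℂ (fun w => Complex.exp (ψ w)) := by fun_prop
  have h1 := norm_iteratedDeriv_le_of_forall_mem_sphere_norm_le n hε
    (hd.diffContOnCl (s := ball z ε)) (C := Real.exp 1 * ‖Complex.exp (ψ z)‖) (by
      intro w hw
      have h2 := h w (by simpa [dist_eq_norm] using (mem_sphere.1 hw).le)
      have h3 : Complex.exp (ψ w) = Complex.exp (ψ w - ψ z) * Complex.exp (ψ z) := by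
        rw [← Complex.exp_add]; ring_nf
      rw [h3, norm_mul]
      gcongr
      rw [Complex.norm_exp]
      exact Real.exp_le_exp.2 ((Complex.re_le_norm _).trans h2))
  rw [norm_mul]
  have h4 : ‖Complex.exp (ψ z)‖ * ‖Complex.exp (-ψ z)‖ = 1 := by
    rw [← norm_mul, ← Complex.exp_add]; simp
  have h5 : (1 / ε) ^ n ≤ (1 / ε) ^ D :=
    pow_le_pow_right₀ (by rwa [one_le_div hε]) hn
  have h6 : (n.factorial : ℝ) ≤ D.factorial := by exact_mod_cast Nat.factorial_le hn
  calc _ ≤ n.factorial * (Real.exp 1 * ‖Complex.exp (ψ z)‖) / ε ^ n * ‖Complex.exp (-ψ z)‖ := by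
        gcongr
    _ = n.factorial * Real.exp 1 * (1 / ε) ^ n * (‖Complex.exp (ψ z)‖ * ‖Complex.exp (-ψ z)‖) := by
        rw [one_div, inv_pow]; ring
    _ = n.factorial * Real.exp 1 * (1 / ε) ^ n := by rw [h4, mul_one]
    _ ≤ _ := by gcongr

/-- Linearly independent zero-free entire functions with sum `1` satisfy, for the circle averages
of the absolute values of the real parts of their logarithms, an a priori estimate of the order
of the logarithm of these averages. -/
theorem exists_circleAverage_le_log {ι : Type*} [Fintype ι] {ψ : ι → ℂ → ℂ}
    (hψ : ∀ i, Differentiable ℂ (ψ i))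
    (hli : LinearIndependent ℂ (fun i z => Complex.exp (ψ i z)))
    (hsum : ∀ z, ∑ i, Complex.exp (ψ i z) = 1) :
    ∃ a b : ℝ, 0 ≤ b ∧ ∀ r ε : ℝ, 0 < r → 0 < ε → ε ≤ 1 →
      (∀ i, ∀ z w : ℂ, ‖z‖ ≤ r → ‖w - z‖ ≤ ε → ‖ψ i w - ψ i z‖ ≤ 1) →
      ∑ i, circleAverage (fun z => |(ψ i z).re|) 0 r ≤ a + b * Real.log (1 / ε) := by
  classical
  have hg : ∀ i, Differentiable ℂ (fun z => Complex.exp (ψ i z)) := fun i => by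
    have := hψ i
    fun_prop
  obtain ⟨n, hn⟩ := exists_det_iteratedDeriv_ne_zero hg hli
  set D := ∑ j, n j
  have hnD : ∀ j, n j ≤ D := fun j => Finset.single_le_sum (fun _ _ => Nat.zero_le _)
    (Finset.mem_univ j)
  -- A generalised Wronskian matrix with each column divided by its exponential; this makes the
  -- entries bounded wherever the `ψ i` oscillate little.
  let A : ℂ → Matrix ι ι ℂ := fun z => Matrix.of fun j i =>
    iteratedDeriv (n j) (fun w => Complex.exp (ψ i w)) z * Complex.exp (-ψ i z)
  let W : ℂ → ℂ := fun z => (A z).det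
  -- The derivative of order `n j` of the constant sum `1`.
  let b : ι → ℂ := fun j => if n j = 0 then 1 else 0
  have hW0 : W 0 ≠ 0 := by
    have : A 0 = Matrix.of fun j i => Complex.exp (-ψ i 0) *
        (Matrix.of fun j i => iteratedDeriv (n j) (fun w => Complex.exp (ψ i w)) 0) j i := by
      ext j i
      simp [A, mul_comm]
    simp only [W]
    rw [this, Matrix.det_mul_row]
    exact mul_ne_zero (Finset.prod_ne_zero_iff.2 fun i _ => Complex.exp_ne_zero _) hn
  have hWd : Differentiable ℂ W := by
    have he : ∀ j i, Differentiable ℂ (fun z => A z j i) := by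
      intro j i
      have h1 : Differentiable ℂ (iteratedDeriv (n j) (fun w => Complex.exp (ψ i w))) :=
        ((hg i).contDiff (n := ⊤)).differentiable_iteratedDeriv (n j)
          (by exact_mod_cast WithTop.coe_lt_top _)
      have := hψ i
      simp only [A, Matrix.of_apply]
      fun_prop
    simp only [W, Matrix.det_apply]
    refine Differentiable.fun_sum fun σ _ => ?_
    refine Differentiable.const_smul ?_ _
    exact Differentiable.fun_finsetProd fun i _ => he _ _
  have hAg : ∀ z, (A z).mulVec (fun i => Complex.exp (ψ i z)) = b := by
    intro z
    ext j
    simp only [Matrix.mulVec, dotProduct, A, Matrix.of_apply, b]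
    have h1 : ∀ i, iteratedDeriv (n j) (fun w => Complex.exp (ψ i w)) z * Complex.exp (-ψ i z)
        * Complex.exp (ψ i z) = iteratedDeriv (n j) (fun w => Complex.exp (ψ i w)) z := by
      intro i
      rw [mul_assoc, ← Complex.exp_add]; simp
    simp only [h1]
    rw [← iteratedDeriv_fun_sum (fun i _ => ((hg i).contDiff (n := (n j : ℕ))).contDiffAt)]
    simp only [hsum]
    rw [iteratedDeriv_const]
  -- Cramer's rule for the system `A * exp ψ = b`. Both `W` and `W * exp (ψ i)` are thus
  -- determinants with bounded entries, as `circleAverage_abs_re_le` requires.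
  have hm : ∀ i z, W z * Complex.exp (ψ i z) = ((A z).updateCol i b).det := by
    intro i z
    rw [← Matrix.cramer_apply, Matrix.cramer_eq_adjugate_mulVec, ← hAg z, Matrix.mulVec_mulVec,
      Matrix.adjugate_mul, Matrix.smul_mulVec, Matrix.one_mulVec]
    rfl
  set k := Fintype.card ι
  refine ⟨∑ i, (2 * (Real.log k.factorial + k * (Real.log D.factorial + 1))
    - 2 * Real.log ‖W 0‖ - (ψ i 0).re), k * (2 * (k * D)), by positivity, ?_⟩
  intro r ε hr hε hε1 hlip
  set E : ℝ := D.factorial * Real.exp 1 * (1 / ε) ^ D with hE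
  have hinv : 1 ≤ 1 / ε := by rwa [one_le_div hε]
  have hE1 : 1 ≤ E := by
    have h1 : (1 : ℝ) ≤ D.factorial := by exact_mod_cast Nat.factorial_pos D
    have h2 : 1 ≤ Real.exp 1 := Real.one_le_exp zero_le_one
    have h3 : 1 ≤ (1 / ε) ^ D := one_le_pow₀ hinv
    calc (1 : ℝ) = 1 * 1 * 1 := by norm_num
      _ ≤ E := by rw [hE]; gcongr
  have hent : ∀ z ∈ sphere (0 : ℂ) r, ∀ j i, ‖A z j i‖ ≤ E := by
    intro z hz j i
    have hz' : ‖z‖ ≤ r := by simpa using (mem_sphere.1 hz).le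
    exact norm_iteratedDeriv_exp_le (hψ i) hε hε1 (fun w hw => hlip i z w hz' hw) (hnD j)
  set K : ℝ := k.factorial • E ^ k with hK
  have hdet : ∀ B : Matrix ι ι ℂ, (∀ j i, ‖B j i‖ ≤ E) → ‖B.det‖ ≤ K := by
    intro B hB
    exact Matrix.det_le (abv := IsAbsoluteValue.toAbsoluteValue (norm : ℂ → ℝ)) hB
  have hlogK : Real.log K = Real.log k.factorial + k * (Real.log D.factorial + 1)
      + k * D * Real.log (1 / ε) := by
    have hkf : (k.factorial : ℝ) ≠ 0 := by exact_mod_cast k.factorial_ne_zero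
    have hDf : (D.factorial : ℝ) ≠ 0 := by exact_mod_cast D.factorial_ne_zero
    have hp : (1 / ε) ^ D ≠ 0 := by positivity
    rw [hK, nsmul_eq_mul, Real.log_mul hkf (by positivity), Real.log_pow, hE,
      Real.log_mul (by positivity) hp, Real.log_mul hDf (Real.exp_ne_zero _), Real.log_exp,
      Real.log_pow]
    ring
  have hi : ∀ i, circleAverage (fun z => |(ψ i z).re|) 0 r
      ≤ (2 * (Real.log k.factorial + k * (Real.log D.factorial + 1))
        - 2 * Real.log ‖W 0‖ - (ψ i 0).re) + 2 * (k * D) * Real.log (1 / ε) := by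
    intro i
    have := circleAverage_abs_re_le hWd (hψ i) hW0 (hm i) hr (K := K)
      (fun z hz => hdet _ (hent z hz)) (fun z hz => hdet _ fun j l => by
        rw [Matrix.updateCol_apply]
        split_ifs
        · refine le_trans ?_ hE1
          simp only [b]
          split_ifs <;> simp
        · exact hent z hz j l)
    rw [hlogK] at this
    linarith
  refine (Finset.sum_le_sum fun i _ => hi i).trans_eq ?_
  rw [Finset.sum_add_distrib, Finset.sum_const, Finset.card_univ]
  simp only [nsmul_eq_mul]
  ring

/-- Let `M r` be one plus the sum of the averages. At the arbitrarily large radii supplied by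
Borel's growth lemma, the a priori estimate applies with `1 / ε` polynomial in `M r` and `r`. So `M
r` is bounded by a constant plus a multiple of `log r` along a sequence of radii, which kills all
Taylor coefficients of positive order. -/
theorem const_of_linearIndependent_of_sum_eq_one {ι : Type*} [Fintype ι] {ψ : ι → ℂ → ℂ}
    (hψ : ∀ i, Differentiable ℂ (ψ i))
    (hli : LinearIndependent ℂ (fun i z => Complex.exp (ψ i z)))
    (hsum : ∀ z, ∑ i, Complex.exp (ψ i z) = 1) (i : ι) (z : ℂ) : ψ i z = ψ i 0 := by
  obtain ⟨a, b, hb, hab⟩ := exists_circleAverage_le_log hψ hli hsum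
  let M : ℝ → ℝ := fun r => 1 + ∑ i, circleAverage (fun z => |(ψ i z).re|) 0 r
  have hav0 : ∀ i r, 0 ≤ circleAverage (fun z => |(ψ i z).re|) 0 r := fun i r =>
    circleAverage_nonneg_of_nonneg (fun _ _ => abs_nonneg _)
  have hM1 : ∀ r, 1 ≤ M r := fun r =>
    le_add_of_nonneg_right (Finset.sum_nonneg fun i _ => hav0 i r)
  have havM : ∀ i r, circleAverage (fun z => |(ψ i z).re|) 0 r ≤ M r := by
    intro i r
    have := Finset.single_le_sum (f := fun i => circleAverage (fun z => |(ψ i z).re|) 0 r)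
      (fun i _ => hav0 i r) (Finset.mem_univ i)
    simp only [M]
    linarith
  have hMc : Continuous M := by
    refine continuous_const.add (continuous_finsetSum _ fun i _ => ?_)
    have := (hψ i).continuous
    exact Continuous.circleAverage (by fun_prop)
  have hgrowth : ∃ a' b' : ℝ, ∀ R : ℝ, ∃ r, R ≤ r ∧ 1 ≤ r ∧ M r ≤ a' + b' * Real.log r := by
    refine ⟨2 * (1 + a + b * Real.log 64 + 3 * b * Real.log (6 * b + 1)), 2 * b, fun R => ?_⟩
    obtain ⟨r, hr, hgr⟩ := exists_growth_le hMc hM1 (max R 1)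
    have hr1 : 1 ≤ r := (le_max_right _ _).trans hr
    refine ⟨r, (le_max_left _ _).trans hr, hr1, ?_⟩
    have hm := hM1 r
    set m := M r with hmdef
    have hm0 : 0 < m := by linarith
    have hr0 : 0 < r := by linarith
    -- With `δ = 1 / m` and `A = 2 * m`, the radius `δ ^ 2 / (16 * A * (r + δ))` is at least this
    -- number, because `r + δ ≤ 2 * r`.
    have hε : 0 < 1 / (64 * m ^ 3 * r) := by positivity
    have hm3 : 1 ≤ m ^ 3 := one_le_pow₀ hm
    have hmr : 1 ≤ 64 * m ^ 3 * r := by nlinarith [mul_le_mul hm3 hr1 zero_le_one (by positivity)]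
    have h1 := hab r (1 / (64 * m ^ 3 * r)) hr0 hε
      (by rw [div_le_one (by positivity)]; exact hmr) (by
        intro i z w hz hw
        refine norm_sub_le_of_circleAverage_le (hψ i) hr0.le (δ := 1 / m) (by positivity)
          (A := 2 * m) (by positivity) ((havM i _).trans hgr) hz (hw.trans (le_min ?_ ?_))
        · rw [div_div, div_le_div_iff₀ (by positivity) (by positivity)]
          have : m ≤ m ^ 3 := le_self_pow₀ hm (by norm_num)
          nlinarith [mul_le_mul this hr1 zero_le_one (by positivity)]
        · have h2 : r + 1 / m ≤ 2 * r := by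
            have : 1 / m ≤ 1 := by rw [div_le_one hm0]; exact hm
            linarith
          calc 1 / (64 * m ^ 3 * r) = (1 / m) ^ 2 / (16 * (2 * m) * (2 * r)) := by
                field_simp; norm_num
            _ ≤ _ := by gcongr)
    rw [one_div_one_div, Real.log_mul (by positivity) hr0.ne', Real.log_mul (by norm_num)
      (by positivity), Real.log_pow] at h1
    -- The scale `6 * b + 1` makes `3 * b * log m` at most `m / 2` plus a constant, so that it can
    -- be absorbed in the left side.
    have h2 : Real.log m ≤ m / (6 * b + 1) + Real.log (6 * b + 1) := by
      have h3 := Real.log_le_sub_one_of_pos (x := m / (6 * b + 1)) (by positivity)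
      rw [Real.log_div hm0.ne' (by positivity)] at h3
      linarith
    have h3 : 3 * b * (m / (6 * b + 1)) ≤ m / 2 := by
      rw [mul_div_assoc', div_le_div_iff₀ (by positivity) (by norm_num)]
      nlinarith
    have h4 : 3 * b * Real.log m ≤ 3 * b * (m / (6 * b + 1) + Real.log (6 * b + 1)) := by gcongr
    have h5 : m = 1 + ∑ i, circleAverage (fun z => |(ψ i z).re|) 0 r := rfl
    push_cast at h1
    linarith
  obtain ⟨a', b', hg⟩ := hgrowth
  have hcoef : ∀ n : ℕ, n ≠ 0 → (n.factorial : ℂ)⁻¹ * iteratedDeriv n (ψ i) 0 = 0 := by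
    intro n hn
    rw [← norm_eq_zero]
    refine eq_zero_of_mul_le_log (a := 2 * a') (b := 2 * b') (norm_nonneg _) fun R => ?_
    obtain ⟨r, hr, hr1, hle⟩ := hg R
    refine ⟨r, hr, ?_⟩
    have h1 := taylorCoeff_mul_pow_le (hψ i) hn (zero_lt_one.trans_le hr1)
    have h2 : r ≤ r ^ n := le_self_pow₀ hr1 hn
    have h3 := havM i r
    calc _ ≤ ‖(n.factorial : ℂ)⁻¹ * iteratedDeriv n (ψ i) 0‖ * r ^ n := by gcongr
      _ ≤ _ := by linarith
  have hs := hasSum_taylorSeries_of_entire (hψ i) 0 z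
  refine hs.unique ?_
  have h1 := hasSum_single (f := fun n : ℕ => (n.factorial : ℂ)⁻¹ • (z - 0) ^ n •
    iteratedDeriv n (ψ i) 0) 0 (fun n hn => by
      simp only [smul_eq_mul]
      rw [mul_left_comm, hcoef n hn, mul_zero])
  simpa using h1

/-- **Borel's theorem**: in a vanishing linear combination, with nonzero coefficients, of
exponentials of entire functions, each exponential is a constant multiple of another one. -/
theorem exists_sub_const_of_sum_exp_eq_zero {ι : Type*} {s : Finset ι} {φ : ι → ℂ → ℂ}
    (hφ : ∀ i, Differentiable ℂ (φ i)) {c : ι → ℂ} (hc : ∀ i ∈ s, c i ≠ 0)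
    (hsum : ∀ z, ∑ i ∈ s, c i * Complex.exp (φ i z) = 0) {i₀ : ι} (hi₀ : i₀ ∈ s) :
    ∃ j ∈ s, j ≠ i₀ ∧ ∀ z, φ j z - φ i₀ z = φ j 0 - φ i₀ 0 := by
  classical
  let v : {i // i ∈ s.erase i₀} → ℂ → ℂ := fun i z => Complex.exp (φ i z - φ i₀ z)
  -- Dividing the relation by its `i₀` term writes `1` as a combination of the `v i`, hence of a
  -- maximal independent subfamily.
  obtain ⟨κ, a, ha, hsp, hla⟩ := exists_linearIndependent' ℂ v
  have : Finite κ := Finite.of_injective a ha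
  have : Fintype κ := Fintype.ofFinite κ
  have h1 : (fun _ : ℂ => (1 : ℂ)) ∈ Submodule.span ℂ (range (v ∘ a)) := by
    rw [hsp]
    have h2 : (fun _ : ℂ => (1 : ℂ)) = ∑ i : {i // i ∈ s.erase i₀}, (-(c i / c i₀)) • v i := by
      ext z
      have h3 := hsum z
      rw [← Finset.add_sum_erase s _ hi₀] at h3
      simp only [Finset.sum_apply, Pi.smul_apply, smul_eq_mul, v]
      rw [Finset.sum_coe_sort (s.erase i₀)
        (fun i => -(c i / c i₀) * Complex.exp (φ i z - φ i₀ z))]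
      have h4 : ∀ i, -(c i / c i₀) * Complex.exp (φ i z - φ i₀ z)
          = -(c i₀ * Complex.exp (φ i₀ z))⁻¹ * (c i * Complex.exp (φ i z)) := by
        intro i
        rw [Complex.exp_sub]
        have := hc i₀ hi₀
        have := Complex.exp_ne_zero (φ i₀ z)
        field_simp
      simp only [h4]
      rw [← Finset.mul_sum, eq_neg_of_add_eq_zero_right h3]
      have := hc i₀ hi₀
      have := Complex.exp_ne_zero (φ i₀ z)
      field_simp
    rw [h2]
    exact Submodule.sum_mem _ fun i _ => Submodule.smul_mem _ _ (Submodule.subset_span ⟨i, rfl⟩)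
  rw [Submodule.mem_span_range_iff_exists_fun] at h1
  obtain ⟨d, hd⟩ := h1
  -- The nonzero coefficients are absorbed into the exponents, giving independent exponentials with
  -- sum `1`. At least one survives, and its exponent is constant.
  let ψ : {k : κ // d k ≠ 0} → ℂ → ℂ := fun k z =>
    Complex.log (d k) + (φ (a k) z - φ i₀ z)
  have hψe : ∀ k z, Complex.exp (ψ k z) = d k * v (a k) z := by
    intro k z
    simp only [ψ, v]
    rw [Complex.exp_add, Complex.exp_log k.2]
  have hψ : ∀ k, Differentiable ℂ (ψ k) := by
    intro k
    have h1 := hφ (a k)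
    have h2 := hφ i₀
    simp only [ψ]
    fun_prop
  have hli : LinearIndependent ℂ (fun k z => Complex.exp (ψ k z)) := by
    have h2 : LinearIndependent ℂ (fun k : {k : κ // d k ≠ 0} => (v ∘ a) k) :=
      hla.comp _ Subtype.val_injective
    have h3 := h2.units_smul (fun k => Units.mk0 (d k) k.2)
    convert h3 using 1
    ext k z
    rw [hψe]
    rfl
  have hs : ∀ z, ∑ k, Complex.exp (ψ k z) = 1 := by
    intro z
    have h2 := congrFun hd z
    simp only [Finset.sum_apply, Pi.smul_apply, smul_eq_mul, Function.comp_apply] at h2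
    rw [← h2]
    simp only [hψe]
    rw [← Finset.sum_subtype (Finset.univ.filter fun k => d k ≠ 0) (by simp)
      (fun k => d k * v (a k) z), Finset.sum_filter_of_ne]
    intro k _ hk h0
    exact hk (by simp [h0])
  have hne : Nonempty {k : κ // d k ≠ 0} := by
    by_contra hempty
    rw [not_nonempty_iff] at hempty
    simpa using hs 0
  obtain ⟨k⟩ := hne
  refine ⟨a k, Finset.mem_of_mem_erase (a k).2, Finset.ne_of_mem_erase (a k).2, fun z => ?_⟩
  have := const_of_linearIndependent_of_sum_eq_one hψ hli hs k z
  simpa [ψ] using this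

end Borel

end HyperplaneSharing

namespace HyperplaneSharing

/-! ### Hartogs extension across sets of codimension two. -/

section Extension

open Metric Set Real

variable {E : Type*} [NormedAddCommGroup E] [NormedSpace ℂ E]

theorem differentiableAt_circleAverage {b : E → ℂ} {U : Set E} (hU : IsOpen U)
    (hb : AnalyticOnNhd ℂ b U) {x₀ α : E} {η : ℝ}
    (h : ∀ s ∈ sphere (0 : ℂ) |η|, x₀ + s • α ∈ U) :
    DifferentiableAt ℂ (fun x => circleAverage (fun s => b (x + s • α)) 0 η) x₀ := by
  have hK : IsCompact (sphere (0 : ℂ) |η|) := isCompact_sphere _ _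
  have hfd : ContinuousOn (fderiv ℂ b) U := hb.fderiv.continuousOn
  have hcont : ContinuousOn (fun s : ℂ => ‖fderiv ℂ b (x₀ + s • α)‖) (sphere 0 |η|) :=
    (hfd.comp (by fun_prop) h).norm
  obtain ⟨C, hC⟩ := hK.bddAbove_image hcont
  have hmem : ∀ᶠ x in 𝓝 x₀, ∀ s ∈ sphere (0 : ℂ) |η|,
      x + s • α ∈ U ∧ ‖fderiv ℂ b (x + s • α)‖ < C + 1 := by
    refine hK.eventually_forall_of_forall_eventually fun s hs => ?_
    have hadd : Tendsto (fun z : E × ℂ => z.1 + z.2 • α) (𝓝 (x₀, s)) (𝓝 (x₀ + s • α)) :=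
      Continuous.tendsto (by fun_prop : Continuous fun z : E × ℂ => z.1 + z.2 • α) (x₀, s)
    have h1 : ∀ᶠ y in 𝓝 (x₀ + s • α), y ∈ U := hU.mem_nhds (h s hs)
    have h2 : ∀ᶠ y in 𝓝 (x₀ + s • α), ‖fderiv ℂ b y‖ < C + 1 := by
      refine (hfd.norm.continuousAt (hU.mem_nhds (h s hs))).eventually_lt_const ?_
      have : ‖fderiv ℂ b (x₀ + s • α)‖ ≤ C := hC ⟨s, hs, rfl⟩
      linarith
    exact hadd.eventually (h1.and h2)
  have hcm : ∀ θ, circleMap 0 η θ ∈ sphere (0 : ℂ) |η| := circleMap_mem_sphere' 0 η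
  have hc1 : ∀ x, (∀ s ∈ sphere (0 : ℂ) |η|, x + s • α ∈ U) →
      Continuous fun θ => b (x + circleMap 0 η θ • α) := by
    intro x hx
    have : ContinuousOn b U := hb.continuousOn
    exact this.comp_continuous (by fun_prop) fun θ => hx _ (hcm θ)
  have hc2 : Continuous fun θ => fderiv ℂ b (x₀ + circleMap 0 η θ • α) :=
    hfd.comp_continuous (by fun_prop) fun θ => h _ (hcm θ)
  have hint := (intervalIntegral.hasFDerivAt_integral_of_dominated_of_fderiv_le
    (μ := MeasureTheory.volume) (a := 0) (b := 2 * π)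
    (F := fun x θ => b (x + circleMap 0 η θ • α))
    (F' := fun x θ => fderiv ℂ b (x + circleMap 0 η θ • α)) (bound := fun _ => C + 1) hmem
    (hmem.mono fun x hx => (hc1 x fun s hs => (hx s hs).1).aestronglyMeasurable)
    ((hc1 x₀ h).intervalIntegrable _ _) hc2.aestronglyMeasurable
    (MeasureTheory.ae_of_all _ fun θ _ x hx => (hx _ (hcm θ)).2.le) intervalIntegrable_const
    (MeasureTheory.ae_of_all _ fun θ _ x hx => by
      have h1 : HasFDerivAt b _ _ := (hb _ (hx _ (hcm θ)).1).differentiableAt.hasFDerivAt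
      exact h1.comp x ((hasFDerivAt_id x).add_const _))).differentiableAt
  exact hint.const_smul ((2 * π)⁻¹)

/-- A function proportional to a vector-valued holomorphic function whose zero set has codimension
at least two is a holomorphic multiple of it. -/
theorem exists_differentiable_smul_eq {n : ℕ} {p α β : E} {F₁ F₂ : E → Fin n → ℂ}
    (h₁ : AnalyticAt ℂ F₁ p) (h₂ : AnalyticAt ℂ F₂ p)
    (hprop : ∀ᶠ w in 𝓝 p, F₁ w ≠ 0 → ∃ c : ℂ, F₂ w = c • F₁ w)
    (hiso : ∀ᶠ t : ℂ × ℂ in 𝓝 0, F₁ (p + t.1 • α + t.2 • β) = 0 → t = 0) :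
    ∃ a : E → ℂ, (∀ᶠ w in 𝓝 p, DifferentiableAt ℂ a w) ∧ ∀ᶠ w in 𝓝 p, F₂ w = a w • F₁ w := by
  obtain ⟨R, hR, hball⟩ := Metric.eventually_nhds_iff_ball.1
    ((h₁.eventually_analyticAt.and h₂.eventually_analyticAt).and hprop)
  have hA1 : AnalyticOnNhd ℂ F₁ (ball p R) := fun w hw => (hball w hw).1.1
  have hA2 : AnalyticOnNhd ℂ F₂ (ball p R) := fun w hw => (hball w hw).1.2
  set U : Set E := {w | w ∈ ball p R ∧ F₁ w ≠ 0} with hUdef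
  have hU : IsOpen U := by
    have : U = ball p R ∩ F₁ ⁻¹' {0}ᶜ := rfl
    rw [this]
    exact hA1.continuousOn.isOpen_inter_preimage isOpen_ball isOpen_compl_singleton
  choose! b hb using fun w (hw : w ∈ U) => (hball w hw.1).2 hw.2
  have hbA : AnalyticOnNhd ℂ b U := by
    intro w hw
    obtain ⟨i, hi⟩ := Function.ne_iff.1 hw.2
    have hi1 : AnalyticAt ℂ (fun y => F₁ y i) w :=
      (ContinuousLinearMap.proj (R := ℂ) (φ := fun _ : Fin n => ℂ) i).analyticAt _ |>.comp
        (hA1 w hw.1)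
    have hi2 : AnalyticAt ℂ (fun y => F₂ y i) w :=
      (ContinuousLinearMap.proj (R := ℂ) (φ := fun _ : Fin n => ℂ) i).analyticAt _ |>.comp
        (hA2 w hw.1)
    refine (hi2.div hi1 hi).congr ?_
    filter_upwards [hU.mem_nhds hw, hi1.continuousAt.eventually_ne hi] with y hy hyi
    have := congrFun (hb y hy) i
    simp only [Pi.smul_apply, smul_eq_mul, Pi.zero_apply] at this hyi
    simp only [Pi.div_apply]
    rw [this, mul_div_cancel_right₀ _ hyi]
  have hmap : Continuous fun t : ℂ × ℂ => p + t.1 • α + t.2 • β := by fun_prop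
  have hin : ∀ᶠ t : ℂ × ℂ in 𝓝 0, p + t.1 • α + t.2 • β ∈ ball p R := by
    refine hmap.continuousAt.eventually (isOpen_ball.mem_nhds ?_)
    simpa using hR
  obtain ⟨η₀, hη₀, hη⟩ := Metric.eventually_nhds_iff_ball.1 (hin.and hiso)
  set η := η₀ / 2
  have hη1 : 0 < η := half_pos hη₀
  have hpt : ∀ s t : ℂ, ‖s‖ ≤ η → ‖t‖ ≤ η → (s, t) ≠ 0 → p + s • α + t • β ∈ U := by
    intro s t hs ht hst
    have hmem : (s, t) ∈ ball (0 : ℂ × ℂ) η₀ := by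
      rw [mem_ball_zero_iff]
      exact (max_le hs ht).trans_lt (half_lt_self hη₀)
    exact ⟨(hη _ hmem).1, fun h0 => hst ((hη _ hmem).2 h0)⟩
  have htube : ∀ K : Set ℂ, IsCompact K → ∀ x₀ : E, (∀ s ∈ K, x₀ + s • α ∈ U) →
      ∀ᶠ x in 𝓝 x₀, ∀ s ∈ K, x + s • α ∈ U := by
    intro K hK x₀ hx
    refine hK.eventually_forall_of_forall_eventually fun s hs => ?_
    have hadd : Tendsto (fun z : E × ℂ => z.1 + z.2 • α) (𝓝 (x₀, s)) (𝓝 (x₀ + s • α)) :=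
      Continuous.tendsto (by fun_prop : Continuous fun z : E × ℂ => z.1 + z.2 • α) (x₀, s)
    exact hadd.eventually (hU.mem_nhds (hx s hs))
  have hcirc : ∀ᶠ x in 𝓝 p, ∀ s ∈ sphere (0 : ℂ) |η|, x + s • α ∈ U := by
    refine htube _ (isCompact_sphere _ _) p fun s hs => ?_
    have hs' : ‖s‖ = η := by simpa [abs_of_pos hη1] using hs
    have := hpt s 0 hs'.le (by simpa using hη1.le) (by
      intro h0
      have : s = 0 := congrArg Prod.fst h0
      rw [this, norm_zero] at hs'
      exact hη1.ne hs')
    simpa using this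
  obtain ⟨δ, hδ, hδb⟩ := Metric.eventually_nhds_iff_ball.1
    (hcirc.and (isOpen_ball.mem_nhds (mem_ball_self hR)))
  -- The circles in direction `α` about points near `p` avoid the zeros of `F₁`, so this average is
  -- holomorphic even where `b = F₂ / F₁` is undefined. It equals `b x` once the whole disc about
  -- `x` avoids the zeros.
  let a : E → ℂ := fun x => circleAverage (fun s => b (x + s • α)) 0 η
  have had : ∀ x ∈ ball p δ, DifferentiableAt ℂ a x := fun x hx =>
    differentiableAt_circleAverage hU hbA (hδb x hx).1
  have hgood : ∀ x, (∀ s ∈ closedBall (0 : ℂ) η, x + s • α ∈ U) → F₂ x = a x • F₁ x := by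
    intro x hx
    have h0 : x ∈ U := by simpa using hx 0 (mem_closedBall_self hη1.le)
    have hd : DifferentiableOn ℂ (fun s : ℂ => b (x + s • α)) (closedBall 0 η) := by
      intro s hs
      have h1 : DifferentiableAt ℂ b (x + s • α) := (hbA _ (hx s hs)).differentiableAt
      exact (h1.comp s (by fun_prop : DifferentiableAt ℂ (fun s : ℂ => x + s • α) s)
        ).differentiableWithinAt
    have h2 : a x = b x := by
      have h3 := ((hd.mono closure_ball_subset_closedBall).diffContOnCl :
        DiffContOnCl ℂ (fun s : ℂ => b (x + s • α)) (ball 0 η))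
      rw [← abs_of_pos hη1] at h3
      simpa using! h3.circleAverage
    rw [h2]
    exact hb x h0
  -- Shifting `p` slightly in direction `β` moves the whole disc off the zero set, since `p` is its
  -- only possible zero in the plane nearby. The identity theorem on the line from this `x₀` to `w`
  -- then carries `F₂ = a • F₁` to `w`.
  obtain ⟨x₀, hx₀δ, hx₀⟩ : ∃ x₀ ∈ ball p δ, ∀ s ∈ closedBall (0 : ℂ) η, x₀ + s • α ∈ U := by
    have hc : Tendsto (fun t : ℂ => p + t • β) (𝓝[≠] 0) (𝓝 p) := by
      have : Continuous fun t : ℂ => p + t • β := by fun_prop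
      have := this.tendsto 0
      simp only [zero_smul, add_zero] at this
      exact this.mono_left nhdsWithin_le_nhds
    have h1 : ∀ᶠ t : ℂ in 𝓝[≠] 0, ‖t‖ ≤ η := by
      refine nhdsWithin_le_nhds ?_
      filter_upwards [closedBall_mem_nhds (0 : ℂ) hη1] with t ht
      simpa using ht
    obtain ⟨t, ⟨ht1, ht2⟩, ht3⟩ := ((hc.eventually (ball_mem_nhds p hδ)).and h1).and
      self_mem_nhdsWithin |>.exists
    refine ⟨p + t • β, ht1, fun s hs => ?_⟩
    have := hpt s t (by simpa using hs) ht2 fun h0 => ht3 (congrArg Prod.snd h0)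
    rwa [add_right_comm] at this
  have hnear := htube _ (isCompact_closedBall (0 : ℂ) η) x₀ hx₀
  refine ⟨a, ?_, ?_⟩
  · filter_upwards [ball_mem_nhds p hδ] with w hw using had w hw
  · filter_upwards [ball_mem_nhds p hδ] with w hw
    set T : Set ℂ := {τ | x₀ + τ • (w - x₀) ∈ ball p δ} with hT
    have hline : Continuous fun τ : ℂ => x₀ + τ • (w - x₀) := by fun_prop
    have hTo : IsOpen T := isOpen_ball.preimage hline
    have hTc : IsPreconnected T := by
      refine Convex.isPreconnected ?_
      intro τ₁ h1 τ₂ h2 u v hu hv huv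
      have := convex_ball p δ h1 h2 hu hv huv
      simp only [hT, Set.mem_ofPred_eq]
      convert this using 1
      rw [smul_add, smul_add, add_add_add_comm, ← add_smul, huv, one_smul, add_smul, smul_assoc,
        smul_assoc]
    have h0T : (0 : ℂ) ∈ T := by simpa [hT] using hx₀δ
    have h1T : (1 : ℂ) ∈ T := by simpa [hT] using hw
    have hdl : DifferentiableOn ℂ (fun τ : ℂ => F₂ (x₀ + τ • (w - x₀))
        - a (x₀ + τ • (w - x₀)) • F₁ (x₀ + τ • (w - x₀))) T := by
      intro τ hτ
      have hl : DifferentiableAt ℂ (fun τ : ℂ => x₀ + τ • (w - x₀)) τ := by fun_prop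
      have e1 : DifferentiableAt ℂ F₁ (x₀ + τ • (w - x₀)) :=
        (hA1 _ (hδb _ hτ).2).differentiableAt
      have e2 : DifferentiableAt ℂ F₂ (x₀ + τ • (w - x₀)) :=
        (hA2 _ (hδb _ hτ).2).differentiableAt
      have e3 := had _ hτ
      exact ((e2.comp τ hl).sub ((e3.comp τ hl).smul (e1.comp τ hl))).differentiableWithinAt
    have hev : (fun τ : ℂ => F₂ (x₀ + τ • (w - x₀))
        - a (x₀ + τ • (w - x₀)) • F₁ (x₀ + τ • (w - x₀))) =ᶠ[𝓝 0] 0 := by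
      have : Tendsto (fun τ : ℂ => x₀ + τ • (w - x₀)) (𝓝 0) (𝓝 x₀) := by
        simpa using hline.tendsto 0
      filter_upwards [this.eventually hnear] with τ hτ
      simp [← hgood _ hτ]
    have := (hdl.analyticOnNhd hTo).eqOn_zero_of_preconnected_of_eventuallyEq_zero hTc h0T hev h1T
    simpa [sub_eq_zero] using this

end Extension

end HyperplaneSharing

namespace HyperplaneSharing

/-! ### From equal divisors to global units. -/

section Units

open Set Metric

theorem Hyperplane.form_ne_zero {n : ℕ} (H : Hyperplane n) : H.form ≠ 0 :=
  Projectivization.rep_nonzero H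

theorem exists_rep_eq_smul {n : ℕ} (v : Fin (n + 1) → ℂ) (hv : v ≠ 0) :
    ∃ c : ℂ, c ≠ 0 ∧ (Projectivization.mk ℂ v hv).rep = c • v := by
  obtain ⟨c, hc⟩ := Projectivization.exists_smul_eq_mk_rep ℂ v hv
  exact ⟨c, c.ne_zero, by rw [← hc]; rfl⟩

theorem mk_mem_points {n : ℕ} {H : Hyperplane n} {v : Fin (n + 1) → ℂ} (hv : v ≠ 0) :
    Projectivization.mk ℂ v hv ∈ H.points ↔ H.form v = 0 := by
  obtain ⟨c, hc, h⟩ := exists_rep_eq_smul v hv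
  change H.form (Projectivization.mk ℂ v hv).rep = 0 ↔ _
  rw [h, map_smul, smul_eq_mul, mul_eq_zero]
  simp [hc]

variable {m n N q : ℕ}

theorem IsReducedRepAt.eventually {I : Set (Fin m → ℂ)} {φ : ∀ z : Fin m → ℂ, z ∉ I → PSpace n}
    {z : Fin m → ℂ} {F : (Fin m → ℂ) → Fin (n + 1) → ℂ} (h : IsReducedRepAt I φ z F) :
    ∀ᶠ w in 𝓝 z, IsReducedRepAt I φ w F :=
  h.1.eventually_analyticAt.and h.2.eventually_nhds

theorem IsReducedRepAt.exists_isolated {I : Set (Fin m → ℂ)}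
    {φ : ∀ z : Fin m → ℂ, z ∉ I → PSpace n} {z : Fin m → ℂ}
    {F : (Fin m → ℂ) → Fin (n + 1) → ℂ} (h : IsReducedRepAt I φ z F) (hI : CodimAtLeastTwo I) :
    ∃ α β : Fin m → ℂ, ∀ᶠ t : ℂ × ℂ in 𝓝 0, F (z + t.1 • α + t.2 • β) = 0 → t = 0 := by
  by_cases hz : z ∈ I
  · obtain ⟨α, β, -, hαβ⟩ := hI z hz
    refine ⟨α, β, ?_⟩
    have hc : Tendsto (fun t : ℂ × ℂ => z + t.1 • α + t.2 • β) (𝓝 0) (𝓝 z) := by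
      have : Continuous fun t : ℂ × ℂ => z + t.1 • α + t.2 • β := by fun_prop
      simpa using this.tendsto 0
    filter_upwards [hαβ, hc.eventually h.2] with t h1 h2 h3
    exact h1 (h2.1.2 h3)
  -- Off `I` the representation does not vanish at `z`, so even the degenerate plane works.
  · refine ⟨0, 0, Eventually.of_forall fun t h0 => (hz ?_).elim⟩
    simp only [smul_zero, add_zero] at h0
    exact (h.2.self_of_nhds).1.2 h0

theorem IsReducedRepAt.frequently_ne_zero {I : Set (Fin m → ℂ)}
    {φ : ∀ z : Fin m → ℂ, z ∉ I → PSpace n} {z : Fin m → ℂ}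
    {F : (Fin m → ℂ) → Fin (n + 1) → ℂ} (h : IsReducedRepAt I φ z F) (hI : CodimAtLeastTwo I) :
    ∃ᶠ w in 𝓝 z, F w ≠ 0 := by
  intro hev
  obtain ⟨α, β, hiso⟩ := h.exists_isolated hI
  have hc : Tendsto (fun t : ℂ => z + t • α + (0 : ℂ) • β) (𝓝[≠] 0) (𝓝 z) := by
    have : Continuous fun t : ℂ => z + t • α + (0 : ℂ) • β := by fun_prop
    have := this.tendsto 0
    simp only [zero_smul, add_zero] at this ⊢
    exact this.mono_left nhdsWithin_le_nhds
  have hc2 : Tendsto (fun t : ℂ => ((t, 0) : ℂ × ℂ)) (𝓝[≠] 0) (𝓝 0) := by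
    have : Continuous fun t : ℂ => ((t, 0) : ℂ × ℂ) := by fun_prop
    exact (this.tendsto 0).mono_left nhdsWithin_le_nhds
  obtain ⟨t, ⟨h1, h2⟩, h3⟩ := ((hc.eventually hev).and (hc2.eventually hiso)).and
    self_mem_nhdsWithin |>.exists
  exact h3 (congrArg Prod.fst (h2 (not_not.1 h1)))

/-- Two reduced representations of a map near the same point differ by a holomorphic unit. -/
theorem IsReducedRepAt.exists_unit {I : Set (Fin m → ℂ)} {φ : ∀ z : Fin m → ℂ, z ∉ I → PSpace n}
    {z : Fin m → ℂ} {F₁ F₂ : (Fin m → ℂ) → Fin (n + 1) → ℂ} (h₁ : IsReducedRepAt I φ z F₁)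
    (h₂ : IsReducedRepAt I φ z F₂) (hI : CodimAtLeastTwo I) :
    ∃ a : (Fin m → ℂ) → ℂ, (∀ᶠ w in 𝓝 z, DifferentiableAt ℂ a w) ∧ a z ≠ 0 ∧
      ∀ᶠ w in 𝓝 z, F₂ w = a w • F₁ w := by
  have key : ∀ {G₁ G₂ : (Fin m → ℂ) → Fin (n + 1) → ℂ}, IsReducedRepAt I φ z G₁ →
      IsReducedRepAt I φ z G₂ → ∃ a : (Fin m → ℂ) → ℂ, (∀ᶠ w in 𝓝 z, DifferentiableAt ℂ a w) ∧
        ∀ᶠ w in 𝓝 z, G₂ w = a w • G₁ w := by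
    intro G₁ G₂ h₁ h₂
    obtain ⟨α, β, hiso⟩ := h₁.exists_isolated hI
    refine exists_differentiable_smul_eq h₁.1 h₂.1 ?_ hiso
    filter_upwards [h₁.2, h₂.2] with w e1 e2 hw
    have hwI : w ∉ I := fun h => hw (e1.1.1 h)
    have hw2 : G₂ w ≠ 0 := fun h => hwI (e2.1.2 h)
    have := (e2.2 hwI hw2).symm.trans (e1.2 hwI hw)
    obtain ⟨c, hc⟩ := (Projectivization.mk_eq_mk_iff' ℂ _ _ hw2 hw).1 this
    exact ⟨c, hc.symm⟩
  obtain ⟨a, had, ha⟩ := key h₁ h₂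
  obtain ⟨b, hbd, hb⟩ := key h₂ h₁
  -- If `a z = 0`, then `b * a ≠ 1` near `z`, and `F₁ = (b * a) • F₁` forces `F₁ = 0` on a
  -- neighbourhood.
  refine ⟨a, had, fun ha0 => ?_, ha⟩
  have hcont : ContinuousAt (fun w => b w * a w) z :=
    hbd.self_of_nhds.continuousAt.mul had.self_of_nhds.continuousAt
  have h0 : ∀ᶠ w in 𝓝 z, b w * a w ≠ 1 := by
    refine hcont.eventually_ne ?_
    simp [ha0]
  refine h₁.frequently_ne_zero hI ?_
  filter_upwards [h0, ha, hb] with w e0 e1 e2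
  rw [not_not]
  by_contra hne
  apply e0
  have : F₁ w = (b w * a w) • F₁ w := by
    rw [mul_smul, ← e1, ← e2]
  have h3 : (1 - b w * a w) • F₁ w = 0 := by
    rw [sub_smul, one_smul, ← this, sub_self]
  rcases smul_eq_zero.1 h3 with h | h
  · exact (sub_eq_zero.1 h).symm
  · exact (hne h).elim

/-- If the image of `f` does not lie in `H`, then no nonempty open set is mapped into `H`. -/
theorem MeromorphicMap.frequently_form_ne_zero (f : MeromorphicMap m n) {H : Hyperplane n}
    (hf : ¬ f.image ⊆ H.points) (z : Fin m → ℂ) :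
    ∃ᶠ w in 𝓝 z, ∃ hw : w ∉ f.indet, f.toFun w hw ∉ H.points := by
  set P : (Fin m → ℂ) → Prop := fun w => ∀ hw : w ∉ f.indet, f.toFun w hw ∈ H.points with hP
  have hrep : ∀ {z F}, IsReducedRepAt f.indet f.toFun z F →
      ∀ᶠ w in 𝓝 z, (P w ↔ H.form (F w) = 0) := by
    intro z F hF
    filter_upwards [hF.2] with w hw
    by_cases h0 : F w = 0
    · simp only [h0, map_zero, iff_true]
      exact fun h => (h (hw.1.2 h0)).elim
    · have hwI : w ∉ f.indet := fun h => h0 (hw.1.1 h)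
      rw [← mk_mem_points h0, ← hw.2 hwI h0]
      exact ⟨fun h => h hwI, fun h _ => h⟩
  -- The interior of the locus mapped into `H` is open, and closed by the identity theorem for local
  -- representations. If nonempty, it is everything by connectedness.
  set Z : Set (Fin m → ℂ) := {z | ∀ᶠ w in 𝓝 z, P w} with hZ
  have hopen : IsOpen Z := isOpen_iff_mem_nhds.2 fun z hz => Filter.Eventually.eventually_nhds hz
  have hclosed : IsClosed Z := by
    refine isClosed_of_closure_subset fun z hz => ?_
    obtain ⟨F, hF⟩ := f.exists_reducedRep z
    obtain ⟨R, hR, hball⟩ := Metric.eventually_nhds_iff_ball.1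
      (hF.1.eventually_analyticAt.and (hrep hF))
    obtain ⟨z', hz', hz'b⟩ := mem_closure_iff.1 hz (ball z R) isOpen_ball (mem_ball_self hR)
    have hA : AnalyticOnNhd ℂ (fun w => H.form (F w)) (ball z R) := fun w hw =>
      ((LinearMap.toContinuousLinearMap H.form).analyticAt (F w)).comp (hball w hw).1
    have hev : (fun w => H.form (F w)) =ᶠ[𝓝 z'] 0 := by
      filter_upwards [hz'b, isOpen_ball.mem_nhds hz'] with w h1 h2
      exact (hball w h2).2.1 h1
    have h0 := hA.eqOn_zero_of_preconnected_of_eventuallyEq_zero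
      (convex_ball z R).isPreconnected hz' hev
    filter_upwards [isOpen_ball.mem_nhds (mem_ball_self hR)] with w hw
    exact (hball w hw).2.2 (h0 hw)
  intro hcon
  have hzZ : z ∈ Z := by
    filter_upwards [hcon] with w hw hwI
    by_contra h
    exact hw ⟨hwI, h⟩
  have huniv : Z = univ := IsClopen.eq_univ ⟨hclosed, hopen⟩ ⟨z, hzZ⟩
  apply hf
  rintro x ⟨w, hw, rfl⟩
  have : w ∈ Z := huniv ▸ mem_univ w
  exact Filter.Eventually.self_of_nhds (p := P) this hw

theorem IsReducedRepAt.frequently_form_ne_zero {f : MeromorphicMap m n} {H : Hyperplane n}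
    (hf : ¬ f.image ⊆ H.points) {z : Fin m → ℂ} {F : (Fin m → ℂ) → Fin (n + 1) → ℂ}
    (hF : IsReducedRepAt f.indet f.toFun z F) : ∃ᶠ w in 𝓝 z, H.form (F w) ≠ 0 := by
  refine (f.frequently_form_ne_zero hf z).mp ?_
  filter_upwards [hF.2] with w hw
  rintro ⟨hwI, h⟩ h0
  have hF0 : F w ≠ 0 := fun h => hwI (hw.1.2 h)
  exact h (by rw [hw.2 hwI hF0, mk_mem_points]; exact h0)

/-- Reduced representations `F`, `G` of `f`, `g` near `z`, and units `u j` near `z` such that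
`(f, H j) = u j * (g, H' j)` for these representations. -/
def IsUnitSystemAt (f : MeromorphicMap m n) (g : MeromorphicMap m N) (H : Fin q → Hyperplane n)
    (H' : Fin q → Hyperplane N) (z : Fin m → ℂ) (F : (Fin m → ℂ) → Fin (n + 1) → ℂ)
    (G : (Fin m → ℂ) → Fin (N + 1) → ℂ) (u : Fin q → (Fin m → ℂ) → ℂ) : Prop :=
  IsReducedRepAt f.indet f.toFun z F ∧ IsReducedRepAt g.indet g.toFun z G ∧
    ∀ j, (∀ᶠ w in 𝓝 z, DifferentiableAt ℂ (u j) w) ∧ u j z ≠ 0 ∧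
      ∀ᶠ w in 𝓝 z, (H j).form (F w) = u j w * (H' j).form (G w)

variable {f : MeromorphicMap m n} {g : MeromorphicMap m N} {H : Fin q → Hyperplane n}
  {H' : Fin q → Hyperplane N}

/-- `(f, H j)` is a local equation of the pullback of `H' j` by `g`, but for a representation of `g`
that may depend on `j`; passing to one common `G` costs only another unit. -/
theorem exists_isUnitSystemAt (hfg : ∀ j, f.pullbackDivisor (H j) = g.pullbackDivisor (H' j))
    (z : Fin m → ℂ) : ∃ F G u, IsUnitSystemAt f g H H' z F G u := by
  obtain ⟨F, hF⟩ := f.exists_reducedRep z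
  obtain ⟨G, hG⟩ := g.exists_reducedRep z
  have : ∀ j, ∃ u : (Fin m → ℂ) → ℂ, (∀ᶠ w in 𝓝 z, DifferentiableAt ℂ u w) ∧ u z ≠ 0 ∧
      ∀ᶠ w in 𝓝 z, (H j).form (F w) = u w * (H' j).form (G w) := by
    intro j
    have hmem : (fun w => (H j).form (F w)) ∈ f.pullbackDivisor (H j) z :=
      ⟨F, fun _ => 1, hF, analyticAt_const, one_ne_zero, Eventually.of_forall fun w => by simp⟩
    rw [hfg j] at hmem
    obtain ⟨G', u, hG', hu, hu0, hev⟩ := hmem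
    obtain ⟨a, had, ha0, ha⟩ := hG.exists_unit hG' g.codim_indet
    refine ⟨fun w => u w * a w, ?_, mul_ne_zero hu0 ha0, ?_⟩
    · filter_upwards [had, hu.eventually_analyticAt] with w h1 h2
      exact h2.differentiableAt.mul h1
    · filter_upwards [hev, ha] with w h1 h2
      rw [h1, h2, map_smul, smul_eq_mul, mul_assoc]
  choose u hu using this
  exact ⟨F, G, u, hF, hG, hu⟩

theorem IsUnitSystemAt.eventually {z : Fin m → ℂ} {F : (Fin m → ℂ) → Fin (n + 1) → ℂ}
    {G : (Fin m → ℂ) → Fin (N + 1) → ℂ} {u : Fin q → (Fin m → ℂ) → ℂ}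
    (h : IsUnitSystemAt f g H H' z F G u) : ∀ᶠ w in 𝓝 z, IsUnitSystemAt f g H H' w F G u := by
  have h3 : ∀ᶠ w in 𝓝 z, ∀ j, (∀ᶠ w' in 𝓝 w, DifferentiableAt ℂ (u j) w') ∧ u j w ≠ 0 ∧
      ∀ᶠ w' in 𝓝 w, (H j).form (F w') = u j w' * (H' j).form (G w') := by
    rw [eventually_all]
    intro j
    obtain ⟨h1, h2, h3⟩ := h.2.2 j
    exact h1.eventually_nhds.and
      ((h1.self_of_nhds.continuousAt.eventually_ne h2).and h3.eventually_nhds)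
  exact h.1.eventually.and (h.2.1.eventually.and h3)

/-- Replacing `F` and `G` by multiples with units `a` and `b` multiplies every `u j` by the same
factor `a / b`. Hence the ratios glue to global functions without any global reduced representation.
-/
theorem IsUnitSystemAt.div_eq_div (hg : ∀ j, ¬ g.image ⊆ (H' j).points) {z : Fin m → ℂ}
    {F₁ F₂ : (Fin m → ℂ) → Fin (n + 1) → ℂ} {G₁ G₂ : (Fin m → ℂ) → Fin (N + 1) → ℂ}
    {u₁ u₂ : Fin q → (Fin m → ℂ) → ℂ} (h₁ : IsUnitSystemAt f g H H' z F₁ G₁ u₁)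
    (h₂ : IsUnitSystemAt f g H H' z F₂ G₂ u₂) (i j : Fin q) :
    u₁ i z / u₁ j z = u₂ i z / u₂ j z := by
  obtain ⟨a, had, ha0, ha⟩ := h₁.1.exists_unit h₂.1 f.codim_indet
  obtain ⟨b, hbd, hb0, hb⟩ := h₁.2.1.exists_unit h₂.2.1 g.codim_indet
  have key : ∀ j, u₂ j z * b z = a z * u₁ j z := by
    intro j
    obtain ⟨d1, -, e1⟩ := h₁.2.2 j
    obtain ⟨d2, -, e2⟩ := h₂.2.2 j
    by_contra hne
    have c1 : ContinuousAt (fun w => u₂ j w * b w) z :=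
      d2.self_of_nhds.continuousAt.mul hbd.self_of_nhds.continuousAt
    have c2 : ContinuousAt (fun w => a w * u₁ j w) z :=
      had.self_of_nhds.continuousAt.mul d1.self_of_nhds.continuousAt
    have hne' : ∀ᶠ w in 𝓝 z, u₂ j w * b w ≠ a w * u₁ j w :=
      ((c1.sub c2).eventually_ne (sub_ne_zero.2 hne)).mono fun w hw => sub_ne_zero.1 hw
    refine h₁.2.1.frequently_form_ne_zero (hg j) ?_
    filter_upwards [hne', e1, e2, ha, hb] with w k0 k1 k2 k3 k4
    rw [not_not]
    by_contra h0
    apply k0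
    rw [k3, k4, map_smul, map_smul, k1, smul_eq_mul, smul_eq_mul] at k2
    apply mul_right_cancel₀ h0
    linear_combination -k2
  have hi := key i
  have hj := key j
  have := (h₁.2.2 j).2.1
  have := (h₂.2.2 j).2.1
  rw [div_eq_div_iff (h₁.2.2 j).2.1 (h₂.2.2 j).2.1]
  apply mul_right_cancel₀ (mul_ne_zero ha0 hb0)
  linear_combination (-(b z) * u₂ j z) * hi + (b z * u₂ i z) * hj

/-- If `f` and `g` have the same pullback divisors of hyperplanes, then there are global units
`h j` with `(f, H j) = h j * (g, H' j)`, for suitable homogeneous coordinates of the values. -/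
theorem exists_unit_system (hg : ∀ j, ¬ g.image ⊆ (H' j).points)
    (hfg : ∀ j, f.pullbackDivisor (H j) = g.pullbackDivisor (H' j)) (i₀ : Fin q) :
    ∃ h : Fin q → (Fin m → ℂ) → ℂ, (∀ j, Differentiable ℂ (h j)) ∧ (∀ j z, h j z ≠ 0) ∧
      ∀ z, ∃ (x : Fin (n + 1) → ℂ) (y : Fin (N + 1) → ℂ),
        ((z ∈ f.indet ↔ x = 0) ∧ ∀ hz hx, f.toFun z hz = Projectivization.mk ℂ x hx) ∧
        ((z ∈ g.indet ↔ y = 0) ∧ ∀ hz hy, g.toFun z hz = Projectivization.mk ℂ y hy) ∧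
        ∀ j, (H j).form x = h j z * (H' j).form y := by
  choose F G u hu using exists_isUnitSystemAt (f := f) (g := g) (H := H) (H' := H') hfg
  have hne : ∀ j z, u z j z ≠ 0 := fun j z => ((hu z).2.2 j).2.1
  refine ⟨fun j z => u z j z / u z i₀ z, ?_, ?_, ?_⟩
  · intro j z
    have hev : (fun w => u w j w / u w i₀ w) =ᶠ[𝓝 z] fun w => u z j w / u z i₀ w := by
      filter_upwards [(hu z).eventually] with w hw
      exact (hu w).div_eq_div hg hw j i₀
    refine DifferentiableAt.congr_of_eventuallyEq ?_ hev
    simp only [div_eq_mul_inv]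
    exact ((hu z).2.2 j).1.self_of_nhds.mul (((hu z).2.2 i₀).1.self_of_nhds.inv (hne i₀ z))
  · exact fun j z => div_ne_zero (hne j z) (hne i₀ z)
  · intro z
    obtain ⟨hF, hG, hj⟩ := hu z
    have hF' := hF.2.self_of_nhds
    have hc : (u z i₀ z)⁻¹ ≠ 0 := inv_ne_zero (hne i₀ z)
    -- Dividing the coordinates of `f` by `u i₀` turns the factors `u j` into the ratios. The
    -- coordinates are chosen separately at each `z`; only the ratios need to be holomorphic.
    refine ⟨(u z i₀ z)⁻¹ • F z z, G z z, ⟨?_, ?_⟩, hG.2.self_of_nhds, ?_⟩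
    · rw [hF'.1, smul_eq_zero_iff_right hc]
    · intro hz hx
      have h0 : F z z ≠ 0 := fun h => hx (by rw [h, smul_zero])
      rw [hF'.2 hz h0, Projectivization.mk_eq_mk_iff']
      exact ⟨u z i₀ z, by rw [smul_smul, mul_inv_cancel₀ (hne i₀ z), one_smul]⟩
    · intro j
      rw [map_smul, (hj j).2.2.self_of_nhds, smul_eq_mul]
      field_simp

end Units

end HyperplaneSharing

namespace HyperplaneSharing

/-! ### Elimination of the coordinates by a determinant. -/

section Determinant

open Finset

/-- The determinant of a square matrix `(A, D B)`, where `D` is the diagonal matrix with entries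
`t k`, is a multiaffine function of `t`. -/
theorem exists_det_eq_sum_prod {α β : Type*} [Fintype α] [Fintype β] [DecidableEq α]
    [DecidableEq β] (A : Matrix (α ⊕ β) α ℂ) (B : Matrix (α ⊕ β) β ℂ) :
    ∃ c : Finset (α ⊕ β) → ℂ, ∀ t : α ⊕ β → ℂ,
      (Matrix.of fun k l => Sum.elim (fun j => A k j) (fun j => t k * B k j) l).det
        = ∑ I ∈ univ.powersetCard (Fintype.card β), c I * ∏ k ∈ I, t k := by
  -- The rows that `σ` assigns to the columns of `B` are those contributing a factor `t k`, so the
  -- terms of the determinant are grouped by this set.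
  let S : Equiv.Perm (α ⊕ β) → Finset (α ⊕ β) := fun σ =>
    (univ : Finset β).map ⟨fun j => σ (Sum.inr j), fun _ _ h => Sum.inr_injective (σ.injective h)⟩
  let w : Equiv.Perm (α ⊕ β) → ℂ := fun σ => (Equiv.Perm.sign σ : ℂ) *
    ((∏ j, A (σ (Sum.inl j)) j) * ∏ j, B (σ (Sum.inr j)) j)
  refine ⟨fun I => ∑ σ with S σ = I, w σ, fun t => ?_⟩
  have hS : ∀ σ ∈ (univ : Finset (Equiv.Perm (α ⊕ β))),
      S σ ∈ (univ : Finset (α ⊕ β)).powersetCard (Fintype.card β) := fun σ _ => by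
    simp [S, mem_powersetCard]
  rw [Matrix.det_apply']
  calc _ = ∑ σ, w σ * ∏ k ∈ S σ, t k := by
        refine sum_congr rfl fun σ _ => ?_
        have : ∏ k ∈ S σ, t k = ∏ j, t (σ (Sum.inr j)) := prod_map _ _ _
        rw [this]
        simp only [Fintype.prod_sum_type, Matrix.of_apply, Sum.elim_inl, Sum.elim_inr, w,
          prod_mul_distrib]
        ring
    _ = ∑ I ∈ univ.powersetCard (Fintype.card β), ∑ σ with S σ = I, w σ * ∏ k ∈ S σ, t k :=
        (sum_fiberwise_of_maps_to hS _).symm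
    _ = _ := by
        refine sum_congr rfl fun I _ => ?_
        rw [sum_mul]
        refine sum_congr rfl fun σ hσ => ?_
        rw [(mem_filter.1 hσ).2]

/-- Up to sign, `c I` is the minor of `B` on the rows `I` times the complementary minor of `A`, and
the hypotheses say that both are nonzero. The relation holds because `(x, -y)` lies in the kernel of
the matrix. -/
theorem exists_coeff_of_det {α β : Type*} [Fintype α] [Fintype β] [DecidableEq α]
    [DecidableEq β] (A : Matrix (α ⊕ β) α ℂ) (B : Matrix (α ⊕ β) β ℂ)
    (hA : ∀ I : Finset (α ⊕ β), I.card = Fintype.card α → ∀ x,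
      (∀ k ∈ I, A.mulVec x k = 0) → x = 0)
    (hB : ∀ I : Finset (α ⊕ β), I.card = Fintype.card β → ∀ y,
      (∀ k ∈ I, B.mulVec y k = 0) → y = 0) :
    ∃ c : Finset (α ⊕ β) → ℂ, (∀ I ∈ univ.powersetCard (Fintype.card β), c I ≠ 0) ∧
      ∀ (t : α ⊕ β → ℂ) (x : α → ℂ) (y : β → ℂ), (x ≠ 0 ∨ y ≠ 0) →
        (∀ k, A.mulVec x k = t k * B.mulVec y k) →
        ∑ I ∈ univ.powersetCard (Fintype.card β), c I * ∏ k ∈ I, t k = 0 := by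
  obtain ⟨c, hc⟩ := exists_det_eq_sum_prod A B
  have hmul : ∀ (t : α ⊕ β → ℂ) (v : α ⊕ β → ℂ) k,
      (Matrix.of fun k l => Sum.elim (fun j => A k j) (fun j => t k * B k j) l).mulVec v k
        = A.mulVec (fun j => v (Sum.inl j)) k + t k * B.mulVec (fun j => v (Sum.inr j)) k := by
    intro t v k
    simp [Matrix.mulVec, dotProduct, Fintype.sum_sum_type, mul_sum, mul_assoc]
  refine ⟨c, fun I hI h0 => ?_, fun t x y hxy h => ?_⟩
  · have hcard := (mem_powersetCard.1 hI).2
    -- At the indicator function of `I` only the term `c I` survives, so its nonvanishing becomes a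
    -- statement about the kernel of a single matrix.
    have hdet := hc fun k => if k ∈ I then 1 else 0
    have hsum : ∑ J ∈ univ.powersetCard (Fintype.card β), c J * ∏ k ∈ J,
        (if k ∈ I then (1 : ℂ) else 0) = 0 := by
      refine sum_eq_zero fun J hJ => ?_
      by_cases hJI : J ⊆ I
      · rw [eq_of_subset_of_card_le hJI (by rw [hcard, (mem_powersetCard.1 hJ).2]), h0, zero_mul]
      · obtain ⟨k, hkJ, hkI⟩ := not_subset.1 hJI
        rw [prod_eq_zero hkJ (by simp [hkI]), mul_zero]
    rw [hsum] at hdet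
    obtain ⟨v, hv, hMv⟩ := Matrix.exists_mulVec_eq_zero_iff.2 hdet
    have hk : ∀ k, _ := fun k => (hmul _ v k).symm.trans (congrFun hMv k)
    have h1 : (fun j => v (Sum.inl j)) = 0 := by
      refine hA Iᶜ ?_ _ fun k hkI => ?_
      · rw [card_compl, hcard, Fintype.card_sum, Nat.add_sub_cancel]
      · have := hk k
        simpa [mem_compl.1 hkI] using this
    have h2 : (fun j => v (Sum.inr j)) = 0 := by
      refine hB I hcard _ fun k hkI => ?_
      have := hk k
      rw [h1] at this
      simpa [hkI] using this
    apply hv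
    ext k
    rcases k with j | j
    · exact congrFun h1 j
    · exact congrFun h2 j
  · rw [← hc]
    refine Matrix.exists_mulVec_eq_zero_iff.1 ⟨Sum.elim x (-y), ?_, ?_⟩
    · intro h0
      rcases hxy with hx | hy
      · exact hx (funext fun j => congrFun h0 (Sum.inl j))
      · refine hy (funext fun j => ?_)
        have := congrFun h0 (Sum.inr j)
        simpa using this
    · ext k
      rw [hmul, Pi.zero_apply]
      have e1 : (fun j => (Sum.elim x (-y) : α ⊕ β → ℂ) (Sum.inl j)) = x := rfl
      have e2 : (fun j => (Sum.elim x (-y) : α ⊕ β → ℂ) (Sum.inr j)) = -y := rfl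
      rw [e1, e2, h k, Matrix.mulVec_neg, Pi.neg_apply]
      ring

theorem form_eq_sum {l : ℕ} (φ : Module.Dual ℂ (Fin l → ℂ)) (x : Fin l → ℂ) :
    φ x = ∑ j, φ (Pi.single j 1) * x j := by
  conv_lhs => rw [pi_eq_sum_univ' x]
  rw [map_sum]
  refine sum_congr rfl fun i _ => ?_
  rw [map_smul, smul_eq_mul, mul_comm]

theorem InGeneralPosition.eq_zero_of_forms_eq_zero {n q : ℕ} {H : Fin q → Hyperplane n}
    (hH : InGeneralPosition H) {s : Finset (Fin q)} (hs : s.card = n + 1) {x : Fin (n + 1) → ℂ}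
    (h : ∀ j ∈ s, (H j).form x = 0) : x = 0 := by
  have hli := hH s hs.le
  have hsp := hli.span_eq_top_of_card_eq_finrank' (by
    rw [Subspace.dual_finrank_eq]; simp [hs])
  rw [← Module.forall_dual_apply_eq_zero_iff ℂ]
  intro φ
  have hφ : φ ∈ Submodule.span ℂ (Set.range fun i : s => (H i).form) := hsp ▸ Submodule.mem_top
  induction hφ using Submodule.span_induction with
  | mem y hy => obtain ⟨i, rfl⟩ := hy; exact h i i.2
  | zero => rfl
  | add a b _ _ ha hb => rw [LinearMap.add_apply, ha, hb, add_zero]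
  | smul a b _ hb => rw [LinearMap.smul_apply, hb, smul_zero]

/-- The relation between the factors `t j` in the equations `H j (x) = t j * H' j (y)` which is
obtained by elimination of `x` and `y`. -/
theorem exists_elimination {n N q : ℕ} {H : Fin q → Hyperplane n} {H' : Fin q → Hyperplane N}
    (hH : InGeneralPosition H) (hH' : InGeneralPosition H') {R : Finset (Fin q)}
    (hR : R.card = n + N + 2) :
    ∃ c : Finset (Fin q) → ℂ, (∀ I ∈ R.powersetCard (N + 1), c I ≠ 0) ∧
      ∀ (t : Fin q → ℂ) (x : Fin (n + 1) → ℂ) (y : Fin (N + 1) → ℂ), (x ≠ 0 ∨ y ≠ 0) →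
        (∀ j, (H j).form x = t j * (H' j).form y) →
        ∑ I ∈ R.powersetCard (N + 1), c I * ∏ j ∈ I, t j = 0 := by
  have hcard : Fintype.card (Fin (n + 1) ⊕ Fin (N + 1)) = Fintype.card R := by
    simp [hR]; ring
  let e : (Fin (n + 1) ⊕ Fin (N + 1)) ≃ R := Fintype.equivOfCardEq hcard
  let r : (Fin (n + 1) ⊕ Fin (N + 1)) ↪ Fin q := e.toEmbedding.trans (Function.Embedding.subtype _)
  have hRr : R = univ.map r := by
    ext j
    simp only [Finset.mem_map, mem_univ, true_and, r]
    constructor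
    · intro hj
      exact ⟨e.symm ⟨j, hj⟩, by simp⟩
    · rintro ⟨k, rfl⟩
      exact (e k).2
  let A : Matrix (Fin (n + 1) ⊕ Fin (N + 1)) (Fin (n + 1)) ℂ :=
    Matrix.of fun k j => (H (r k)).form (Pi.single j 1)
  let B : Matrix (Fin (n + 1) ⊕ Fin (N + 1)) (Fin (N + 1)) ℂ :=
    Matrix.of fun k j => (H' (r k)).form (Pi.single j 1)
  have hAx : ∀ x k, A.mulVec x k = (H (r k)).form x := fun x k => (form_eq_sum _ x).symm
  have hBy : ∀ y k, B.mulVec y k = (H' (r k)).form y := fun y k => (form_eq_sum _ y).symm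
  obtain ⟨c, hc0, hc⟩ := exists_coeff_of_det A B
    (fun I hI x hx => hH.eq_zero_of_forms_eq_zero (s := I.map r) (by simpa using hI) (by
      intro j hj
      obtain ⟨k, hk, rfl⟩ := Finset.mem_map.1 hj
      rw [← hAx]
      exact hx k hk))
    (fun I hI y hy => hH'.eq_zero_of_forms_eq_zero (s := I.map r) (by simpa using hI) (by
      intro j hj
      obtain ⟨k, hk, rfl⟩ := Finset.mem_map.1 hj
      rw [← hBy]
      exact hy k hk))
  rw [Fintype.card_fin] at hc0 hc
  refine ⟨fun I => c (I.preimage r r.injective.injOn), ?_, ?_⟩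
  · intro I hI
    rw [hRr, powersetCard_map, Finset.mem_map] at hI
    obtain ⟨J, hJ, rfl⟩ := hI
    simpa using hc0 J hJ
  · intro t x y hxy h
    rw [hRr, powersetCard_map, sum_map]
    refine Eq.trans (sum_congr rfl fun J _ => ?_) (hc (fun k => t (r k)) x y hxy fun k => ?_)
    · simp [prod_map]
    · rw [hAx, hBy, h]

end Determinant

/-! ### Real weights encoding multiplicative relations between units. -/

section Weights

open Set

theorem exists_exp_eq {u : ℂ → ℂ} (hu : Differentiable ℂ u) (h0 : ∀ t, u t ≠ 0) :
    ∃ φ : ℂ → ℂ, Differentiable ℂ φ ∧ ∀ t, Complex.exp (φ t) = u t := by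
  obtain ⟨F, hF⟩ := (hu.deriv.div hu h0).isExactOn_univ
  have hF' : ∀ t, HasDerivAt F (deriv u t / u t) t := fun t => hF t (mem_univ t)
  have hconst : ∀ t, u t * Complex.exp (-F t) = u 0 * Complex.exp (-F 0) := by
    have hd : ∀ t, HasDerivAt (fun t => u t * Complex.exp (-F t)) 0 t := by
      intro t
      have := (hu t).hasDerivAt.mul (hF' t).neg.cexp
      refine this.congr_deriv ?_
      have := h0 t
      field_simp
      ring
    intro t
    exact is_const_of_deriv_eq_zero (fun t => (hd t).differentiableAt) (fun t => (hd t).deriv) t 0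
  refine ⟨fun t => F t + Complex.log (u 0 * Complex.exp (-F 0)), fun t =>
    ((hF' t).add_const _).differentiableAt, fun t => ?_⟩
  rw [Complex.exp_add, Complex.exp_log (mul_ne_zero (h0 0) (Complex.exp_ne_zero _)), ← hconst t,
    mul_left_comm, ← Complex.exp_add, add_neg_cancel, Complex.exp_zero, mul_one]

/-- Finitely many entire functions which do not vanish identically have a common nonzero. -/
theorem exists_forall_ne_zero {E ι : Type*} [NormedAddCommGroup E] [NormedSpace ℂ E]
    (s : Finset ι) {K : ι → E → ℂ} (hK : ∀ i ∈ s, Differentiable ℂ (K i))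
    (h : ∀ i ∈ s, ∃ v, K i v ≠ 0) : ∃ v, ∀ i ∈ s, K i v ≠ 0 := by
  classical
  have two : ∀ {f g : E → ℂ}, Differentiable ℂ f → Differentiable ℂ g → (∃ v, f v ≠ 0) →
      (∃ v, g v ≠ 0) → ∃ v, f v ≠ 0 ∧ g v ≠ 0 := by
    rintro f g hf hg ⟨a, ha⟩ ⟨b, hb⟩
    by_contra! hcon
    have hl : Differentiable ℂ fun τ : ℂ => a + τ • (b - a) := by fun_prop
    have hf' : AnalyticOnNhd ℂ (fun τ : ℂ => f (a + τ • (b - a))) univ :=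
      fun τ _ => (hf.comp hl).analyticAt τ
    have hg' : AnalyticOnNhd ℂ (fun τ : ℂ => g (a + τ • (b - a))) univ :=
      fun τ _ => (hg.comp hl).analyticAt τ
    rcases AnalyticOnNhd.eq_zero_or_eq_zero_of_mul_eq_zero hf' hg' (fun τ _ => by
      by_cases hz : f (a + τ • (b - a)) = 0
      · simp [hz]
      · simp [hcon _ hz]) isPreconnected_univ with h | h
    · exact ha (by simpa using h 0 (mem_univ _))
    · exact hb (by simpa using h 1 (mem_univ _))
  have hprod : Differentiable ℂ (fun v => ∏ i ∈ s, K i v) ∧ ∃ v, ∏ i ∈ s, K i v ≠ 0 := by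
    induction s using Finset.induction_on with
    | empty => exact ⟨by simp, 0, by simp⟩
    | insert i s hi ih =>
      have h1 := ih (fun j hj => hK j (Finset.mem_insert_of_mem hj))
        (fun j hj => h j (Finset.mem_insert_of_mem hj))
      have hKi := hK i (Finset.mem_insert_self _ _)
      obtain ⟨v, hv1, hv2⟩ := two hKi h1.1 (h i (Finset.mem_insert_self _ _)) h1.2
      simp only [Finset.prod_insert hi]
      exact ⟨hKi.mul h1.1, v, mul_ne_zero hv1 hv2⟩
  obtain ⟨-, v, hv⟩ := hprod
  exact ⟨v, fun i hi => Finset.prod_ne_zero_iff.1 hv i hi⟩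

/-- For units `h j` with `H j (x) = h j * H' j (y)`, there are real weights `p j` which, by
Borel's theorem, satisfy additive relations, and such that simple additive relations between the
weights come from multiplicative relations, up to constants, between the units. -/
theorem exists_weights {m n N q : ℕ} {H : Fin q → Hyperplane n} {H' : Fin q → Hyperplane N}
    (hH : InGeneralPosition H) (hH' : InGeneralPosition H') {h : Fin q → (Fin m → ℂ) → ℂ}
    (hd : ∀ j, Differentiable ℂ (h j)) (h0 : ∀ j z, h j z ≠ 0)
    (hdense : Dense {z | ∃ (x : Fin (n + 1) → ℂ) (y : Fin (N + 1) → ℂ), (x ≠ 0 ∨ y ≠ 0) ∧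
      ∀ j, (H j).form x = h j z * (H' j).form y}) :
    ∃ p : Fin q → ℝ,
      (∀ R : Finset (Fin q), R.card = n + N + 2 → ∀ I ∈ R.powersetCard (N + 1),
        ∃ J ∈ R.powersetCard (N + 1), J ≠ I ∧ ∑ j ∈ J, p j = ∑ j ∈ I, p j) ∧
      (∀ i j k, p i + p j = 2 * p k → ∃ κ : ℂ, κ ≠ 0 ∧ ∀ z, h i z * h j z = κ * h k z ^ 2) ∧
      ∀ i j, (∃ κ : ℂ, ∀ z, h i z = κ * h j z) → p i = p j := by
  classical
  -- The only constant that can occur in `h i * h j = κ * h k ^ 2`, read off at the origin.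
  let κ : Fin q × Fin q × Fin q → ℂ := fun a => h a.1 0 * h a.2.1 0 / h a.2.2 0 ^ 2
  let K : Fin q × Fin q × Fin q → (Fin m → ℂ) → ℂ := fun a z =>
    h a.1 z * h a.2.1 z - κ a * h a.2.2 z ^ 2
  have hKd : ∀ a, Differentiable ℂ (K a) := fun a => by
    have h1 := hd a.1
    have h2 := hd a.2.1
    have h3 := hd a.2.2
    simp only [K]
    fun_prop
  -- A relation that fails somewhere on `ℂ ^ m` already fails at `v`. Hence relations valid on the
  -- line `ℂ • v` hold everywhere.
  obtain ⟨v, hv⟩ := exists_forall_ne_zero (Finset.univ.filter fun a => ∃ z, K a z ≠ 0)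
    (fun a _ => hKd a) (fun a ha => (Finset.mem_filter.1 ha).2)
  have hline : Differentiable ℂ fun t : ℂ => t • v := by fun_prop
  choose φ hφ hφe using fun j => exists_exp_eq ((hd j).comp hline) (fun t => h0 j (t • v))
  have hφe' : ∀ j t, Complex.exp (φ j t) = h j (t • v) := hφe
  let e : Fin q → ℂ → ℂ := fun j t => φ j t - φ j 0
  let ι := {a : Fin q × Fin q × Fin q // e a.1 + e a.2.1 - (2 : ℝ) • e a.2.2 ≠ 0}
  -- A real functional vanishing on none of the finitely many nonzero `e i + e j - 2 • e k`, so a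
  -- relation of this shape between weights lifts to the logarithms.
  obtain ⟨P, hP⟩ := Module.exists_dual_forall_apply_ne_zero (K := ℝ)
    (fun a : ι => e a.1.1 + e a.1.2.1 - (2 : ℝ) • e a.1.2.2) (fun a => a.2)
  refine ⟨fun j => P (e j), ?_, ?_, ?_⟩
  · intro R hR I hI
    obtain ⟨c, hc0, hc⟩ := exists_elimination hH hH' hR
    have hall : ∀ z, ∑ J ∈ R.powersetCard (N + 1), c J * ∏ j ∈ J, h j z = 0 := by
      have hcont : Continuous fun z => ∑ J ∈ R.powersetCard (N + 1), c J * ∏ j ∈ J, h j z := by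
        refine continuous_finsetSum _ fun J _ => continuous_const.mul ?_
        exact continuous_finsetProd _ fun j _ => (hd j).continuous
      have := hcont.ext_on hdense continuous_const (g := fun _ => 0) (by
        rintro z ⟨x, y, hxy, hj⟩
        exact hc (fun j => h j z) x y hxy hj)
      exact fun z => congrFun this z
    obtain ⟨J, hJ, hJI, hconst⟩ := exists_sub_const_of_sum_exp_eq_zero
      (s := R.powersetCard (N + 1)) (φ := fun J t => ∑ j ∈ J, φ j t)
      (fun J => Differentiable.fun_sum fun j _ => hφ j) hc0 (fun t => by
        simp only [Complex.exp_sum, hφe']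
        exact hall _) hI
    refine ⟨J, hJ, hJI, ?_⟩
    rw [← map_sum, ← map_sum]
    congr 1
    ext t
    simp only [Finset.sum_apply, e, Finset.sum_sub_distrib]
    linear_combination hconst t
  · intro i j k hp
    have hzero : e i + e j - (2 : ℝ) • e k = 0 := by
      by_contra hne
      apply hP ⟨(i, j, k), hne⟩
      rw [map_sub, map_add, map_smul, hp, smul_eq_mul, sub_self]
    have h1 := congrFun hzero 1
    simp only [Pi.sub_apply, Pi.add_apply, Pi.smul_apply, e, Pi.zero_apply, Complex.real_smul,
      Complex.ofReal_ofNat] at h1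
    have h2 : φ i 1 + φ j 1 - (2 : ℕ) * φ k 1 = φ i 0 + φ j 0 - (2 : ℕ) * φ k 0 := by
      push_cast
      linear_combination h1
    have h3 := congrArg Complex.exp h2
    rw [Complex.exp_sub, Complex.exp_sub, Complex.exp_add, Complex.exp_add, Complex.exp_nat_mul,
      Complex.exp_nat_mul] at h3
    simp only [hφe', one_smul, zero_smul] at h3
    refine ⟨κ (i, j, k), div_ne_zero (mul_ne_zero (h0 _ _) (h0 _ _)) (pow_ne_zero _ (h0 _ _)), ?_⟩
    by_contra! hcon
    obtain ⟨z, hz⟩ := hcon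
    apply hv (i, j, k) (Finset.mem_filter.2 ⟨Finset.mem_univ _, z, sub_ne_zero.2 hz⟩)
    simp only [K, κ, ← h3]
    rw [div_mul_cancel₀ _ (pow_ne_zero _ (h0 _ _)), sub_self]
  · rintro i j ⟨c, hc⟩
    have hexp : ∀ t, Complex.exp (φ i t - φ j t) = c := by
      intro t
      rw [Complex.exp_sub, hφe', hφe', hc, mul_div_cancel_right₀ _ (h0 _ _)]
    have hder : ∀ t, deriv (fun t => φ i t - φ j t) t = 0 := by
      intro t
      have h1 : HasDerivAt (fun t => φ i t - φ j t) _ t := ((hφ i).sub (hφ j) t).hasDerivAt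
      have h2 := h1.cexp
      simp only [hexp] at h2
      have h3 := h2.unique (hasDerivAt_const t c)
      have hc0 : c ≠ 0 := hexp 0 ▸ Complex.exp_ne_zero _
      exact (mul_eq_zero.1 h3).resolve_left hc0
    have hconst := is_const_of_deriv_eq_zero ((hφ i).sub (hφ j)) hder
    have hij : e i = e j := funext fun t => by
      have := hconst t 0
      simp only [Pi.sub_apply] at this
      simp only [e]
      linear_combination this
    exact congrArg P hij

end Weights

end HyperplaneSharing

namespace HyperplaneSharing

/-! ### Combinatorics of weights with the exchange property. -/

section Combinatorics

open Finset

/-- Every `b`-element subset of an `a`-element set `R` has the same sum of weights as another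
`b`-element subset of `R`. -/
def HasExchangeProperty {ι : Type*} (a b : ℕ) (p : ι → ℝ) : Prop :=
  ∀ R : Finset ι, R.card = a → ∀ I ∈ R.powersetCard b,
    ∃ J ∈ R.powersetCard b, J ≠ I ∧ ∑ j ∈ J, p j = ∑ j ∈ I, p j

variable {ι : Type*} {p : ι → ℝ} {a b : ℕ}

theorem HasExchangeProperty.neg (hp : HasExchangeProperty a b p) :
    HasExchangeProperty a b (fun j => -p j) := by
  intro R hR I hI
  obtain ⟨J, hJ, hJI, h⟩ := hp R hR I hI
  exact ⟨J, hJ, hJI, by simp only [sum_neg_distrib, h]⟩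

/-- Otherwise every weight on `B` would exceed every weight on `A`, and `A` would be the unique
`b`-subset of `A ∪ B` of least weight. -/
theorem HasExchangeProperty.exists_le [DecidableEq ι] (hp : HasExchangeProperty a b p)
    {A B : Finset ι} (hAB : Disjoint A B) (hA : A.card = b) (hB : A.card + B.card = a) :
    ∃ i ∈ A, ∃ j ∈ B, p j ≤ p i := by
  obtain ⟨J, hJ, hJA, hsum⟩ := hp (A ∪ B) (by rw [card_union_of_disjoint hAB, hB]) A
    (mem_powersetCard.2 ⟨subset_union_left, hA⟩)
  obtain ⟨hJs, hJc⟩ := mem_powersetCard.1 hJ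
  by_contra! hcon
  have hcard : (J \ A).card = (A \ J).card := by
    have h1 := card_sdiff_add_card_inter J A
    have h2 := card_sdiff_add_card_inter A J
    rw [inter_comm] at h2
    omega
  have hne : (A \ J).Nonempty := by
    rw [nonempty_iff_ne_empty, Ne, sdiff_eq_empty_iff_subset]
    intro h
    exact hJA (eq_of_subset_of_card_le h (by omega)).symm
  obtain ⟨i₀, hi₀, hmax⟩ := exists_max_image (A \ J) p hne
  have hlt : ∀ j ∈ J \ A, p i₀ < p j := by
    intro j hj
    obtain ⟨h1, h2⟩ := mem_sdiff.1 hj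
    exact hcon i₀ (mem_sdiff.1 hi₀).1 j ((mem_union.1 (hJs h1)).resolve_left h2)
  have h1 : ∑ j ∈ A \ J, p j ≤ (A \ J).card • p i₀ := sum_le_card_nsmul _ _ _ hmax
  have h2 : (J \ A).card • p i₀ < ∑ j ∈ J \ A, p j := by
    rw [← sum_const]
    exact sum_lt_sum_of_nonempty (card_pos.1 (by rw [hcard]; exact card_pos.2 hne)) hlt
  have h3 := sum_sdiff_sub_sum_sdiff (s₁ := A) (s₂ := J) (f := p)
  rw [hcard] at h2
  linarith

/-- If weights in increasing order have the exchange property, then the weights in the middle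
coincide. -/
theorem HasExchangeProperty.exists_sort {n N q : ℕ} {p : Fin q → ℝ}
    (hp : HasExchangeProperty (n + N + 2) (N + 1) p) (hq : n + N + 2 ≤ q)
    (hNq : 2 * N + 1 ≤ q) :
    ∃ σ : Equiv.Perm (Fin q), Monotone (p ∘ σ) ∧
      ∀ i j : Fin q, n ≤ (i : ℕ) → (i : ℕ) + n < q → n ≤ (j : ℕ) → (j : ℕ) + n < q →
        p (σ i) = p (σ j) := by
  classical
  set σ := Tuple.sort p
  have hmono : Monotone (p ∘ σ) := Tuple.monotone_sort p
  refine ⟨σ, hmono, ?_⟩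
  have low : ∀ c d : ℕ, c + d ≤ q → ((univ.filter fun i : Fin q => (i : ℕ) < c).map
      σ.toEmbedding).card = c ∧ ((univ.filter fun i : Fin q => q ≤ (i : ℕ) + d).map
      σ.toEmbedding).card = d ∧ Disjoint ((univ.filter fun i : Fin q => (i : ℕ) < c).map
      σ.toEmbedding) ((univ.filter fun i : Fin q => q ≤ (i : ℕ) + d).map σ.toEmbedding) := by
    intro c d hcd
    refine ⟨?_, ?_, ?_⟩
    · rw [card_map, Fin.card_filter_val_lt]
      omega
    · have h1 : (univ.filter fun i : Fin q => q ≤ (i : ℕ) + d)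
          = (univ.filter fun i : Fin q => ¬ ((i : ℕ) < q - d)) := by
        ext i
        simp only [mem_filter, mem_univ, true_and]
        omega
      have h2 := card_filter_add_card_filter_not (s := (univ : Finset (Fin q)))
        (fun i : Fin q => (i : ℕ) < q - d)
      rw [Fin.card_filter_val_lt, card_univ, Fintype.card_fin] at h2
      rw [card_map, h1]
      omega
    · rw [Finset.disjoint_map, disjoint_filter]
      intro i _ h1 h2
      omega
  -- Compare the `N + 1` lowest weights with the `n + 1` highest: the weight of rank `N`, counted
  -- from zero, is at least that of rank `q - n - 1`.
  have h1 : ∀ i j : Fin q, N ≤ (i : ℕ) → (j : ℕ) + n < q → p (σ j) ≤ p (σ i) := by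
    intro i j hi hj
    obtain ⟨e1, e2, e3⟩ := low (N + 1) (n + 1) (by omega)
    obtain ⟨a, ha, b, hb, hab⟩ := hp.exists_le e3 e1 (by omega)
    obtain ⟨k, hk, rfl⟩ := Finset.mem_map.1 ha
    obtain ⟨l, hl, rfl⟩ := Finset.mem_map.1 hb
    have hk' := (mem_filter.1 hk).2
    have hl' := (mem_filter.1 hl).2
    have h2 : p (σ j) ≤ p (σ l) := hmono (Fin.le_def.2 (by omega))
    have h3 : p (σ k) ≤ p (σ i) := hmono (Fin.le_def.2 (by omega))
    exact h2.trans (hab.trans h3)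
  have h2 : ∀ i j : Fin q, n ≤ (i : ℕ) → (j : ℕ) + N < q → p (σ j) ≤ p (σ i) := by
    intro i j hi hj
    obtain ⟨e1, e2, e3⟩ := low (n + 1) (N + 1) (by omega)
    obtain ⟨a, ha, b, hb, hab⟩ := hp.neg.exists_le e3.symm e2 (by omega)
    obtain ⟨k, hk, rfl⟩ := Finset.mem_map.1 ha
    obtain ⟨l, hl, rfl⟩ := Finset.mem_map.1 hb
    have hk' := (mem_filter.1 hk).2
    have hl' := (mem_filter.1 hl).2
    have h2 : p (σ j) ≤ p (σ k) := hmono (Fin.le_def.2 (by omega))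
    have h3 : p (σ l) ≤ p (σ i) := hmono (Fin.le_def.2 (by omega))
    exact h2.trans ((neg_le_neg_iff.1 hab).trans h3)
  -- The two comparisons are chained through rank `N`, which is admissible in the second one because
  -- `2 * N + 1 ≤ q`.
  have key : ∀ i j : Fin q, n ≤ (i : ℕ) → (j : ℕ) + n < q → p (σ j) ≤ p (σ i) := by
    intro i j hi hj
    have e1 := h1 ⟨N, by omega⟩ j le_rfl hj
    have e2 := h2 i ⟨N, by omega⟩ hi (by simp only; omega)
    exact e1.trans e2
  intro i j hi hi' hj hj'
  exact le_antisymm (key j i hj hi') (key i j hi hj')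

/-- Among `L` and `M`, the weight of `x` is nearest to `s`. Apply the exchange property to `(X \
{x}) ∪ S` inside `X ∪ S ∪ M`, where `X ⊆ L` has `d + 1` elements including `x`. With weights centred
at `s`, what the partner `J` omits from `X` must balance `x` together with what it takes from `M`.
By minimality, either `J` takes a weight opposite to that of `x`, or it omits another element with
the weight of `x`. -/
theorem HasExchangeProperty.exists_opposite [DecidableEq ι] {n d : ℕ} {S L M : Finset ι} {s : ℝ}
    {x : ι} (hp : HasExchangeProperty (n + (n + d) + 2) (n + d + 1) p) (hS : S.card = n + 1)
    (hL : d + 1 ≤ L.card) (hM : M.card = n) (hSs : ∀ i ∈ S, p i = s) (hLs : ∀ i ∈ L, p i < s)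
    (hMs : ∀ i ∈ M, s < p i) (hx : x ∈ L) (hxL : ∀ i ∈ L, p i ≤ p x)
    (hxM : ∀ i ∈ M, s - p x ≤ p i - s) :
    ∃ j, j ≠ x ∧ p j ≠ s ∧ (p x + p j = 2 * s ∨ p x = p j) := by
  obtain ⟨X, hxX, hXL, hXc⟩ := exists_subsuperset_card_eq (singleton_subset_iff.2 hx)
    (by simp : ({x} : Finset ι).card ≤ d + 1) hL
  rw [singleton_subset_iff] at hxX
  have hXS : Disjoint X S := disjoint_left.2 fun i h1 h2 =>
    (hLs i (hXL h1)).ne (hSs i h2)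
  have hXM : Disjoint X M := disjoint_left.2 fun i h1 h2 =>
    (hLs i (hXL h1)).asymm (hMs i h2)
  have hSM : Disjoint S M := disjoint_left.2 fun i h1 h2 => (hMs i h2).ne' (hSs i h1)
  have hXSM : Disjoint (X ∪ S) M := disjoint_union_left.2 ⟨hXM, hSM⟩
  have heS : Disjoint (X.erase x) S := hXS.mono_left (erase_subset _ _)
  obtain ⟨J, hJ, hJI, hsum⟩ := hp (X ∪ S ∪ M)
    (by rw [card_union_of_disjoint hXSM, card_union_of_disjoint hXS]; omega) (X.erase x ∪ S)
    (mem_powersetCard.2 ⟨(union_subset_union_left (erase_subset _ _)).trans subset_union_left, by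
      rw [card_union_of_disjoint heS, card_erase_of_mem hxX]; omega⟩)
  obtain ⟨hJs, hJc⟩ := mem_powersetCard.1 hJ
  have hIc : (X.erase x ∪ S).card = n + d + 1 := by
    rw [card_union_of_disjoint heS, card_erase_of_mem hxX]; omega
  have hsum' : ∑ j ∈ J, (p j - s) = ∑ j ∈ X.erase x ∪ S, (p j - s) := by
    rw [sum_sub_distrib, sum_sub_distrib, hsum, sum_const, sum_const, hJc, hIc]
  have hS0 : ∀ A ⊆ S, ∑ j ∈ A, (p j - s) = 0 := fun A hA =>
    sum_eq_zero fun j hj => by rw [hSs j (hA hj), sub_self]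
  have hJsplit : J = (J ∩ X) ∪ (J ∩ S) ∪ (J ∩ M) := by
    rw [← inter_union_distrib_left, ← inter_union_distrib_left, inter_eq_left.2 hJs]
  have hD : ∑ j ∈ X \ J, (p j - s) = (p x - s) + ∑ j ∈ J ∩ M, (p j - s) := by
    have e1 : ∑ j ∈ J, (p j - s)
        = ∑ j ∈ J ∩ X, (p j - s) + ∑ j ∈ J ∩ S, (p j - s) + ∑ j ∈ J ∩ M, (p j - s) := by
      conv_lhs => rw [hJsplit]
      rw [sum_union, sum_union]
      · exact hXS.mono inter_subset_right inter_subset_right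
      · rw [← inter_union_distrib_left]
        exact hXSM.mono inter_subset_right inter_subset_right
    rw [hS0 _ inter_subset_right] at e1
    have e2 : ∑ j ∈ X.erase x ∪ S, (p j - s) = ∑ j ∈ X.erase x, (p j - s) := by
      rw [sum_union heS, hS0 S subset_rfl, add_zero]
    have e3 := add_sum_erase X (fun j => p j - s) hxX
    have e4 := sum_inter_add_sum_sdiff X J (fun j => p j - s)
    rw [inter_comm] at e4
    linarith
  have hV : ∀ j ∈ J ∩ M, 0 < p j - s := fun j hj => sub_pos.2 (hMs j (mem_inter.1 hj).2)
  have hV0 : 0 ≤ ∑ j ∈ J ∩ M, (p j - s) := sum_nonneg fun j hj => (hV j hj).le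
  have hDn : ∀ j ∈ X \ J, p j - s < 0 := fun j hj =>
    sub_neg.2 (hLs j (hXL (mem_sdiff.1 hj).1))
  have hxs := hLs x hx
  rcases (X \ J).eq_empty_or_nonempty with hempty | ⟨i, hi⟩
  · rw [hempty, sum_empty] at hD
    have hne : (J ∩ M).Nonempty := by
      rw [nonempty_iff_ne_empty]
      intro h
      rw [h, sum_empty] at hD
      linarith
    obtain ⟨y, hy⟩ := hne
    have h1 := single_le_sum (fun j hj => (hV j hj).le) hy
    have hyM := (mem_inter.1 hy).2
    have h2 := hxM y hyM
    have h3 := hMs y hyM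
    refine ⟨y, fun h => ?_, h3.ne', Or.inl ?_⟩
    · rw [h] at h3
      linarith
    · linarith
  · have hle : ∀ i ∈ X \ J, ∑ j ∈ X \ J, (p j - s) ≤ p i - s := by
      intro i hi
      rw [← add_sum_erase _ _ hi]
      have : ∑ j ∈ (X \ J).erase i, (p j - s) ≤ 0 :=
        sum_nonpos fun j hj => (hDn j (mem_of_mem_erase hj)).le
      linarith
    by_cases hix : ∃ i ∈ X \ J, i ≠ x
    · obtain ⟨i, hi, hne⟩ := hix
      have h1 := hle i hi
      have h2 := hxL i (hXL (mem_sdiff.1 hi).1)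
      refine ⟨i, hne, (sub_neg.1 (hDn i hi)).ne, Or.inr (le_antisymm ?_ h2)⟩
      linarith
    -- If `x` alone is omitted, nothing can be taken from `M`, so `J` is the original set, contrary
    -- to its choice.
    · push Not at hix
      have h1 := hle i hi
      rw [hix i hi] at h1
      have hVe : J ∩ M = ∅ := by
        by_contra hne
        have : 0 < ∑ j ∈ J ∩ M, (p j - s) :=
          sum_pos hV (nonempty_iff_ne_empty.2 hne)
        linarith
      have hxJ : x ∉ J := by
        have := hix i hi
        rw [this] at hi
        exact (mem_sdiff.1 hi).2
      exfalso
      apply hJI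
      refine eq_of_subset_of_card_le ?_ (by omega)
      intro j hj
      rcases mem_union.1 (hJs hj) with h | h
      · rcases mem_union.1 h with h | h
        · exact mem_union_left _ (mem_erase.2 ⟨fun hjx => hxJ (hjx ▸ hj), h⟩)
        · exact mem_union_right _ h
      · have : j ∈ J ∩ M := mem_inter.2 ⟨hj, h⟩
        rw [hVe] at this
        simp at this

theorem exists_finset_of_interval {q : ℕ} (σ : Equiv.Perm (Fin q)) (a c : ℕ) (hac : a + c ≤ q) :
    ∃ S : Finset (Fin q), S.card = c ∧
      ∀ i ∈ S, ∃ k : Fin q, a ≤ (k : ℕ) ∧ (k : ℕ) < a + c ∧ i = σ k := by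
  refine ⟨(univ : Finset (Fin c)).map
    ⟨fun k : Fin c => σ ⟨a + k, by omega⟩, fun k l h => ?_⟩, by simp, ?_⟩
  · have := congrArg Fin.val (σ.injective h)
    simp only [add_right_inj] at this
    exact Fin.ext this
  · intro i hi
    obtain ⟨k, -, rfl⟩ := Finset.mem_map.1 hi
    exact ⟨⟨a + k, by omega⟩, by simp, by simp, rfl⟩

/-- The `q - 2 * n ≥ n + 2` middle weights coincide. -/
theorem HasExchangeProperty.exists_card_eq {n N q : ℕ} {p : Fin q → ℝ}
    (hp : HasExchangeProperty (n + N + 2) (N + 1) p) (hN : 2 * N ≤ 3 * n)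
    (hq : 3 * n + 2 ≤ q) :
    ∃ S : Finset (Fin q), S.card = n + 2 ∧ ∀ i ∈ S, ∀ j ∈ S, p i = p j := by
  obtain ⟨σ, -, hσ⟩ := hp.exists_sort (by omega) (by omega)
  obtain ⟨S, hS, h⟩ := exists_finset_of_interval σ n (n + 2) (by omega)
  refine ⟨S, hS, fun i hi j hj => ?_⟩
  obtain ⟨k, hk, hk', rfl⟩ := h i hi
  obtain ⟨l, hl, hl', rfl⟩ := h j hj
  exact hσ k l hk (by omega) hl (by omega)

/-- Only `q = 3 * n + 1` is new: the ranks `n, …, 2 * n` share the weight `s`. Unless a neighbouring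
rank shares it too, `exists_opposite` applies to whichever neighbour is nearer to `s`, after
negating the weights if this is the upper one. -/
theorem HasExchangeProperty.exists_card_eq_or {n N q : ℕ} {p : Fin q → ℝ}
    (hp : HasExchangeProperty (n + N + 2) (N + 1) p) (hn : 1 ≤ n) (hnN : n ≤ N)
    (hN : 2 * N ≤ 3 * n) (hq : 3 * n + 1 ≤ q) :
    (∃ S : Finset (Fin q), S.card = n + 2 ∧ ∀ i ∈ S, ∀ j ∈ S, p i = p j) ∨
      ∃ (S : Finset (Fin q)) (s : ℝ) (x y : Fin q), S.card = n + 1 ∧ (∀ i ∈ S, p i = s) ∧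
        x ≠ y ∧ p x ≠ s ∧ p y ≠ s ∧ (p x + p y = 2 * s ∨ p x = p y) := by
  classical
  rcases hq.lt_or_eq with hq | hq
  · exact Or.inl (hp.exists_card_eq hN hq)
  obtain ⟨σ, hmono, hσ⟩ := hp.exists_sort (by omega) (by omega)
  have hle : ∀ k l : Fin q, (k : ℕ) ≤ l → p (σ k) ≤ p (σ l) := fun k l h => hmono (Fin.le_def.2 h)
  set s := p (σ ⟨n, by omega⟩) with hs
  have hmid : ∀ k : Fin q, n ≤ (k : ℕ) → (k : ℕ) ≤ 2 * n → p (σ k) = s := fun k h1 h2 =>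
    hσ k _ h1 (by omega) le_rfl (by simp only; omega)
  set x : Fin q := σ ⟨n - 1, by omega⟩ with hx
  set y : Fin q := σ ⟨2 * n + 1, by omega⟩ with hy
  by_cases hxs : p x = s
  · left
    obtain ⟨S, hS, h⟩ := exists_finset_of_interval σ (n - 1) (n + 2) (by omega)
    have hall : ∀ i ∈ S, p i = s := by
      intro i hi
      obtain ⟨k, hk, hk', rfl⟩ := h i hi
      rcases hk.eq_or_lt with e | e
      · have : k = ⟨n - 1, by omega⟩ := Fin.ext e.symm
        rw [this]; exact hxs
      · exact hmid k (by omega) (by omega)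
    exact ⟨S, hS, fun i hi j hj => (hall i hi).trans (hall j hj).symm⟩
  by_cases hys : p y = s
  · left
    obtain ⟨S, hS, h⟩ := exists_finset_of_interval σ n (n + 2) (by omega)
    have hall : ∀ i ∈ S, p i = s := by
      intro i hi
      obtain ⟨k, hk, hk', rfl⟩ := h i hi
      rcases eq_or_ne (k : ℕ) (2 * n + 1) with e | e
      · have : k = ⟨2 * n + 1, by omega⟩ := Fin.ext e
        rw [this]; exact hys
      · exact hmid k (by omega) (by omega)
    exact ⟨S, hS, fun i hi j hj => (hall i hi).trans (hall j hj).symm⟩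
  right
  have hxs' : p x < s := lt_of_le_of_ne (hle _ _ (by simp only; omega)) hxs
  have hys' : s < p y := lt_of_le_of_ne (hle _ _ (by simp only; omega)) (Ne.symm hys)
  obtain ⟨S, hS, hS'⟩ := exists_finset_of_interval σ n (n + 1) (by omega)
  obtain ⟨d, rfl⟩ := Nat.exists_eq_add_of_le hnN
  have hSs : ∀ i ∈ S, p i = s := by
    intro i hi
    obtain ⟨k, hk, hk', rfl⟩ := hS' i hi
    exact hmid k hk (by omega)
  set L : Finset (Fin q) := (univ.filter fun i : Fin q => (i : ℕ) < n).map σ.toEmbedding with hL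
  set M : Finset (Fin q) := (univ.filter fun i : Fin q => ¬ ((i : ℕ) < 2 * n + 1)).map
    σ.toEmbedding with hM
  have hLc : L.card = n := by
    rw [hL, card_map, Fin.card_filter_val_lt]; omega
  have hMc : M.card = n := by
    have h2 := card_filter_add_card_filter_not (s := (univ : Finset (Fin q)))
      (fun i : Fin q => (i : ℕ) < 2 * n + 1)
    rw [Fin.card_filter_val_lt, card_univ, Fintype.card_fin] at h2
    rw [hM, card_map]
    omega
  have hLx : ∀ i ∈ L, p i ≤ p x := by
    intro i hi
    obtain ⟨k, hk, rfl⟩ := Finset.mem_map.1 hi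
    have := (mem_filter.1 hk).2
    exact hle _ _ (by simp only; omega)
  have hMy : ∀ i ∈ M, p y ≤ p i := by
    intro i hi
    obtain ⟨k, hk, rfl⟩ := Finset.mem_map.1 hi
    have := (mem_filter.1 hk).2
    exact hle _ _ (by simp only; omega)
  have hxL : x ∈ L := Finset.mem_map.2 ⟨⟨n - 1, by omega⟩, by
    simp only [mem_filter, mem_univ, true_and]; omega, rfl⟩
  have hyM : y ∈ M := Finset.mem_map.2 ⟨⟨2 * n + 1, by omega⟩, by
    simp only [mem_filter, mem_univ, true_and]; omega, rfl⟩
  rcases le_total (s - p x) (p y - s) with h | h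
  · obtain ⟨j, hj1, hj2, hj3⟩ := hp.exists_opposite hS (by omega) hMc hSs
      (fun i hi => (hLx i hi).trans_lt hxs') (fun i hi => hys'.trans_le (hMy i hi)) hxL hLx
      (fun i hi => h.trans (by have := hMy i hi; linarith))
    exact ⟨S, s, x, j, hS, hSs, hj1.symm, hxs, hj2, hj3⟩
  · obtain ⟨j, hj1, hj2, hj3⟩ := hp.neg.exists_opposite (s := -s) hS (by omega : d + 1 ≤ M.card) hLc
      (fun i hi => by rw [hSs i hi]) (fun i hi => neg_lt_neg (hys'.trans_le (hMy i hi)))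
      (fun i hi => neg_lt_neg ((hLx i hi).trans_lt hxs')) hyM
      (fun i hi => neg_le_neg (hMy i hi)) (fun i hi => by have := hLx i hi; linarith)
    refine ⟨S, s, y, j, hS, hSs, hj1.symm, hys, fun h => hj2 (by rw [h]), ?_⟩
    rcases hj3 with h | h
    · left; linarith
    · right; linarith

end Combinatorics

end HyperplaneSharing

namespace HyperplaneSharing

/-! ### Linear forms, their divisibility, and the maps they determine. -/

section LinearAlgebraLemmas

theorem exists_eq_smul_of_forall_eq_zero {V : Type*} [AddCommGroup V] [Module ℂ V]
    {u v : Module.Dual ℂ V} (h : ∀ w, u w = 0 → v w = 0) : ∃ c : ℂ, ∀ w, v w = c * u w := by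
  by_cases hu : u = 0
  · exact ⟨0, fun w => by rw [h w (by rw [hu]; rfl), zero_mul]⟩
  · obtain ⟨w₀, hw₀⟩ : ∃ w, u w ≠ 0 := by
      by_contra! hcon
      exact hu (LinearMap.ext hcon)
    refine ⟨v w₀ / u w₀, fun w => ?_⟩
    have h1 := h (u w₀ • w - u w • w₀) (by simp [mul_comm])
    simp only [map_sub, map_smul, smul_eq_mul] at h1
    field_simp
    linear_combination h1

/-- If a linear form divides a product of two linear forms, then it divides one of them. -/
theorem exists_eq_smul_or_of_forall_eq_zero {V : Type*} [AddCommGroup V] [Module ℂ V]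
    {u v₁ v₂ : Module.Dual ℂ V} (h : ∀ w, u w = 0 → v₁ w = 0 ∨ v₂ w = 0) :
    (∃ c : ℂ, ∀ w, v₁ w = c * u w) ∨ ∃ c : ℂ, ∀ w, v₂ w = c * u w := by
  by_cases h1 : ∀ w, u w = 0 → v₁ w = 0
  · exact Or.inl (exists_eq_smul_of_forall_eq_zero h1)
  by_cases h2 : ∀ w, u w = 0 → v₂ w = 0
  · exact Or.inr (exists_eq_smul_of_forall_eq_zero h2)
  push Not at h1 h2
  obtain ⟨a, ha, ha1⟩ := h1
  obtain ⟨b, hb, hb2⟩ := h2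
  have ha2 : v₂ a = 0 := (h a ha).resolve_left ha1
  have hb1 : v₁ b = 0 := (h b hb).resolve_right hb2
  rcases h (a + b) (by rw [map_add, ha, hb, add_zero]) with h3 | h3
  · rw [map_add, hb1, add_zero] at h3
    exact (ha1 h3).elim
  · rw [map_add, ha2, zero_add] at h3
    exact (hb2 h3).elim

/-- The linear form `φ` as a polynomial. -/
noncomputable def formPoly {l : ℕ} (φ : Module.Dual ℂ (Fin l → ℂ)) : MvPolynomial (Fin l) ℂ :=
  ∑ j, MvPolynomial.C (φ (Pi.single j 1)) * MvPolynomial.X j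

theorem eval_formPoly {l : ℕ} (φ : Module.Dual ℂ (Fin l → ℂ)) (x : Fin l → ℂ) :
    MvPolynomial.eval x (formPoly φ) = φ x := by
  rw [form_eq_sum φ x]
  simp [formPoly, map_sum]

theorem isHomogeneous_formPoly {l : ℕ} (φ : Module.Dual ℂ (Fin l → ℂ)) :
    (formPoly φ).IsHomogeneous 1 := by
  refine MvPolynomial.IsHomogeneous.sum _ _ _ fun j _ => ?_
  exact MvPolynomial.isHomogeneous_C_mul_X _ _

end LinearAlgebraLemmas

section Hyperplanes

variable {m n N q : ℕ}

theorem MeromorphicMap.InNoHypersurfaceOfDegreeLE.linearlyNondegenerate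
    {g : MeromorphicMap m N} {D : ℕ} (hD : 1 ≤ D) (hg : g.InNoHypersurfaceOfDegreeLE D) :
    g.LinearlyNondegenerate := by
  intro K hK
  refine hg 1 le_rfl hD (formPoly K.form) (isHomogeneous_formPoly _) (fun h0 => ?_) fun p hp => ?_
  · apply K.form_ne_zero
    refine LinearMap.ext fun x => ?_
    rw [← eval_formPoly, h0]
    simp
  · change MvPolynomial.eval p.rep _ = 0
    rw [eval_formPoly]
    exact hK hp

theorem MeromorphicMap.ext_of_toFun_eq {f g : MeromorphicMap m n} (hI : f.indet = g.indet)
    (h : ∀ z hz hz', f.toFun z hz = g.toFun z hz') : f = g := by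
  obtain ⟨If, Ff, hf1, hf2⟩ := f
  obtain ⟨Ig, Fg, hg1, hg2⟩ := g
  obtain rfl : If = Ig := hI
  obtain rfl : Ff = Fg := funext fun z => funext fun hz => h z hz hz
  rfl

theorem projMap_image_points {H : Hyperplane n} {H' : Hyperplane N}
    (L : (Fin (N + 1) → ℂ) ≃ₗ[ℂ] (Fin (n + 1) → ℂ)) {c : ℂ} (hc : c ≠ 0)
    (h : ∀ v, H.form (L v) = c * H'.form v) : projMap L '' H'.points = H.points := by
  have hmk : ∀ v (hv : v ≠ 0), projMap L (Projectivization.mk ℂ v hv)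
      = Projectivization.mk ℂ (L v) (by simpa using hv) := fun v hv => rfl
  ext p
  constructor
  · rintro ⟨p', hp', rfl⟩
    induction p' using Projectivization.ind with
    | h v hv =>
      rw [hmk, mk_mem_points, h, (mk_mem_points hv).1 hp', mul_zero]
  · intro hp
    induction p using Projectivization.ind with
    | h w hw =>
      have hw' : L.symm w ≠ 0 := by simpa using hw
      refine ⟨Projectivization.mk ℂ (L.symm w) hw', ?_, ?_⟩
      · rw [mk_mem_points] at hp ⊢
        have := h (L.symm w)
        rw [L.apply_symm_apply, hp] at this
        exact (mul_eq_zero.1 this.symm).resolve_left hc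
      · rw [hmk]
        simp

/-- Hyperplanes in general position which correspond, under a linear map into an `n + 1`
dimensional space, to other hyperplanes are at most `n + 1` in number. -/
theorem InGeneralPosition.card_le_of_forms_comp_eq {H : Fin q → Hyperplane n}
    {H' : Fin q → Hyperplane N} (hH' : InGeneralPosition H')
    (A : (Fin (N + 1) → ℂ) →ₗ[ℂ] (Fin (n + 1) → ℂ)) {T : Finset (Fin q)} (hT : T.card ≤ N + 1)
    (τ : Fin q → Fin q) (c : Fin q → ℂ) (hc : ∀ j ∈ T, c j ≠ 0)
    (h : ∀ j ∈ T, ∀ v, (H (τ j)).form (A v) = c j * (H' j).form v) : T.card ≤ n + 1 := by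
  have h1 := (hH' T hT).units_smul fun j => Units.mk0 (c j) (hc j j.2)
  have h2 : LinearIndependent ℂ (A.dualMap ∘ fun j : T => (H (τ j)).form) := by
    convert h1 using 1
    ext1 j
    refine LinearMap.ext fun v => ?_
    simpa using! h j j.2 v
  have h3 := h2.of_comp.fintype_card_le_finrank
  rw [Subspace.dual_finrank_eq] at h3
  simpa using h3

/-- A linear map which makes prescribed multiples of linear forms correspond to the coordinates
given by `n + 1` hyperplanes in general position. -/
theorem InGeneralPosition.exists_linearMap {H : Fin q → Hyperplane n} (hH : InGeneralPosition H)
    (H' : Fin q → Hyperplane N) {S : Finset (Fin q)} (hS : S.card = n + 1) (c : Fin q → ℂ) :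
    ∃ A : (Fin (N + 1) → ℂ) →ₗ[ℂ] (Fin (n + 1) → ℂ),
      ∀ j ∈ S, ∀ v, (H j).form (A v) = c j * (H' j).form v := by
  let Φ : (Fin (n + 1) → ℂ) →ₗ[ℂ] (S → ℂ) := LinearMap.pi fun j => (H j).form
  have hinj : Function.Injective Φ := by
    rw [← LinearMap.ker_eq_bot, LinearMap.ker_eq_bot']
    intro v hv
    exact hH.eq_zero_of_forms_eq_zero hS fun j hj => congrFun hv ⟨j, hj⟩
  let e := LinearEquiv.ofInjectiveOfFinrankEq Φ hinj (by simp [hS])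
  let Ψ : (Fin (N + 1) → ℂ) →ₗ[ℂ] (S → ℂ) := LinearMap.pi fun j => c j • (H' j).form
  refine ⟨e.symm.toLinearMap ∘ₗ Ψ, fun j hj v => ?_⟩
  have h1 : Φ (e.symm (Ψ v)) = Ψ v := e.apply_symm_apply (Ψ v)
  exact congrFun h1 ⟨j, hj⟩

end Hyperplanes

/-! ### From proportional units to the projective linear map. -/

section UnitSystem

variable {m n N q : ℕ}

/-- Homogeneous coordinates `x z`, `y z` of the values of `f` and `g`, and units `h j` with
`(f, H j) = h j * (g, H' j)`. -/
structure IsUnitSystem (f : MeromorphicMap m n) (g : MeromorphicMap m N)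
    (H : Fin q → Hyperplane n) (H' : Fin q → Hyperplane N) (h : Fin q → (Fin m → ℂ) → ℂ)
    (x : (Fin m → ℂ) → Fin (n + 1) → ℂ) (y : (Fin m → ℂ) → Fin (N + 1) → ℂ) : Prop where
  differentiable : ∀ j, Differentiable ℂ (h j)
  ne_zero : ∀ j z, h j z ≠ 0
  mem_left : ∀ z, z ∈ f.indet ↔ x z = 0
  left_eq : ∀ z hz hx, f.toFun z hz = Projectivization.mk ℂ (x z) hx
  mem_right : ∀ z, z ∈ g.indet ↔ y z = 0
  right_eq : ∀ z hz hy, g.toFun z hz = Projectivization.mk ℂ (y z) hy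
  form_eq : ∀ j z, (H j).form (x z) = h j z * (H' j).form (y z)

variable {f : MeromorphicMap m n} {g : MeromorphicMap m N} {H : Fin q → Hyperplane n}
  {H' : Fin q → Hyperplane N} {h : Fin q → (Fin m → ℂ) → ℂ}
  {x : (Fin m → ℂ) → Fin (n + 1) → ℂ} {y : (Fin m → ℂ) → Fin (N + 1) → ℂ}

theorem exists_isUnitSystem (hg : ∀ j, ¬ g.image ⊆ (H' j).points)
    (hfg : ∀ j, f.pullbackDivisor (H j) = g.pullbackDivisor (H' j)) (i₀ : Fin q) :
    ∃ h x y, IsUnitSystem f g H H' h x y := by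
  obtain ⟨h, hd, h0, hxy⟩ := exists_unit_system hg hfg i₀
  choose x y hx hy hj using hxy
  exact ⟨h, x, y, hd, h0, fun z => (hx z).1, fun z => (hx z).2, fun z => (hy z).1,
    fun z => (hy z).2, fun j z => hj z j⟩

theorem IsUnitSystem.frequently_form_ne_zero (hs : IsUnitSystem f g H H' h x y)
    (hg : ∀ j, ¬ g.image ⊆ (H' j).points) (j : Fin q) (z : Fin m → ℂ) :
    ∃ᶠ w in 𝓝 z, (H' j).form (y w) ≠ 0 := by
  refine (g.frequently_form_ne_zero (hg j) z).mono fun w => ?_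
  rintro ⟨hw, h1⟩ h0
  have hy : y w ≠ 0 := fun h => hw ((hs.mem_right w).2 h)
  exact h1 (by rw [hs.right_eq w hw hy, mk_mem_points]; exact h0)

theorem IsUnitSystem.exists_weights (hs : IsUnitSystem f g H H' h x y)
    (hH : InGeneralPosition H) (hH' : InGeneralPosition H')
    (hg : ∀ j, ¬ g.image ⊆ (H' j).points) (i₀ : Fin q) :
    ∃ p : Fin q → ℝ, HasExchangeProperty (n + N + 2) (N + 1) p ∧
      (∀ i j k, p i + p j = 2 * p k → ∃ κ : ℂ, κ ≠ 0 ∧ ∀ z, h i z * h j z = κ * h k z ^ 2) ∧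
      ∀ i j, (∃ κ : ℂ, ∀ z, h i z = κ * h j z) → p i = p j := by
  refine HyperplaneSharing.exists_weights hH hH' hs.differentiable hs.ne_zero fun z => ?_
  rw [mem_closure_iff_frequently]
  refine (hs.frequently_form_ne_zero hg i₀ z).mono fun w hw => ?_
  exact ⟨x w, y w, Or.inr fun h0 => hw (by rw [h0, map_zero]), fun j => hs.form_eq j w⟩

theorem IsUnitSystem.form_eq_zero (hs : IsUnitSystem f g H H' h x y)
    (hg : g.LinearlyNondegenerate) {φ : Module.Dual ℂ (Fin (N + 1) → ℂ)}
    (hφ : ∀ z, φ (y z) = 0) : φ = 0 := by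
  by_contra hne
  refine hg (Projectivization.mk ℂ φ hne) ?_
  rintro p ⟨z, hz, rfl⟩
  have hy : y z ≠ 0 := fun h => hz ((hs.mem_right z).2 h)
  rw [hs.right_eq z hz hy, mk_mem_points]
  obtain ⟨c, hc⟩ := Projectivization.exists_smul_eq_mk_rep ℂ φ hne
  change (Projectivization.mk ℂ φ hne).rep (y z) = 0
  rw [← hc]
  change (c : ℂ) • φ (y z) = 0
  rw [hφ, smul_zero]

/-- The difference of the two sides is a quadratic form vanishing on the image of `g`, which lies in
no quadric; hence it is the zero polynomial. -/
theorem IsUnitSystem.form_mul_form_eq (hs : IsUnitSystem f g H H' h x y) {D : ℕ} (hD : 2 ≤ D)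
    (hg : g.InNoHypersurfaceOfDegreeLE D) {φ₁ φ₂ ψ₁ ψ₂ : Module.Dual ℂ (Fin (N + 1) → ℂ)} {κ : ℂ}
    (hφ : ∀ z, φ₁ (y z) * φ₂ (y z) = κ * (ψ₁ (y z) * ψ₂ (y z))) (v : Fin (N + 1) → ℂ) :
    φ₁ v * φ₂ v = κ * (ψ₁ v * ψ₂ v) := by
  set P := formPoly φ₁ * formPoly φ₂ - MvPolynomial.C κ * (formPoly ψ₁ * formPoly ψ₂)
  have heval : ∀ v, MvPolynomial.eval v P = φ₁ v * φ₂ v - κ * (ψ₁ v * ψ₂ v) := fun v => by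
    simp [P, eval_formPoly]
  have hP : P.IsHomogeneous 2 :=
    ((isHomogeneous_formPoly φ₁).mul (isHomogeneous_formPoly φ₂)).sub
      (((isHomogeneous_formPoly ψ₁).mul (isHomogeneous_formPoly ψ₂)).C_mul κ)
  have hP0 : P = 0 := by
    by_contra hne
    refine hg 2 one_le_two hD P hP hne ?_
    rintro p ⟨z, hz, rfl⟩
    have hy : y z ≠ 0 := fun h => hz ((hs.mem_right z).2 h)
    rw [hs.right_eq z hz hy]
    obtain ⟨c, -, hc⟩ := exists_rep_eq_smul (y z) hy
    change MvPolynomial.eval _ P = 0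
    rw [hc, heval]
    simp only [map_smul, smul_eq_mul]
    linear_combination c ^ 2 * hφ z
  have := heval v
  rw [hP0, map_zero] at this
  exact (sub_eq_zero.1 this.symm)

/-- If `n + 1` of the units are proportional, then `f = A g` for a linear map `A`. -/
theorem IsUnitSystem.exists_linearMap (hs : IsUnitSystem f g H H' h x y)
    (hH : InGeneralPosition H) {S : Finset (Fin q)} (hS : S.card = n + 1) {s : Fin q}
    {c : Fin q → ℂ} (hc : ∀ j ∈ S, ∀ z, h j z = c j * h s z) :
    ∃ A : (Fin (N + 1) → ℂ) →ₗ[ℂ] (Fin (n + 1) → ℂ),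
      (∀ j ∈ S, ∀ v, (H j).form (A v) = c j * (H' j).form v) ∧
        ∀ z, x z = h s z • A (y z) := by
  obtain ⟨A, hA⟩ := hH.exists_linearMap H' hS c
  refine ⟨A, hA, fun z => ?_⟩
  rw [← sub_eq_zero]
  refine hH.eq_zero_of_forms_eq_zero hS fun j hj => ?_
  rw [map_sub, map_smul, hs.form_eq, hA j hj, hc j hj, smul_eq_mul]
  ring

theorem IsUnitSystem.eq_comp {f g : MeromorphicMap m n} {H H' : Fin q → Hyperplane n}
    {y : (Fin m → ℂ) → Fin (n + 1) → ℂ} (hs : IsUnitSystem f g H H' h x y) {s : Fin q}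
    {L : (Fin (n + 1) → ℂ) ≃ₗ[ℂ] (Fin (n + 1) → ℂ)} (hL : ∀ z, x z = h s z • L (y z)) :
    f = g.comp L := by
  have hiff : ∀ z, x z = 0 ↔ y z = 0 := fun z => by
    rw [hL, smul_eq_zero_iff_right (hs.ne_zero s z), L.map_eq_zero_iff]
  refine MeromorphicMap.ext_of_toFun_eq (Set.ext fun z => ?_) fun z hz hz' => ?_
  · rw [hs.mem_left, hiff, ← hs.mem_right]
    rfl
  · have hx : x z ≠ 0 := fun h => hz ((hs.mem_left z).2 h)
    have hy : y z ≠ 0 := fun h => hx ((hiff z).2 h)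
    change _ = projMap L (g.toFun z hz')
    rw [hs.left_eq z hz hx, hs.right_eq z hz' hy]
    change _ = Projectivization.mk ℂ (L (y z)) _
    rw [Projectivization.mk_eq_mk_iff']
    exact ⟨h s z, (hL z).symm⟩

theorem InGeneralPosition.exists_linearEquiv {H H' : Fin q → Hyperplane n}
    (hH' : InGeneralPosition H') {S : Finset (Fin q)} (hS : S.card = n + 1) {c : Fin q → ℂ}
    (hc : ∀ j ∈ S, c j ≠ 0) {A : (Fin (n + 1) → ℂ) →ₗ[ℂ] (Fin (n + 1) → ℂ)}
    (hA : ∀ j ∈ S, ∀ v, (H j).form (A v) = c j * (H' j).form v) :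
    ∃ L : (Fin (n + 1) → ℂ) ≃ₗ[ℂ] (Fin (n + 1) → ℂ), ∀ v, L v = A v := by
  have hinj : Function.Injective A := by
    rw [← LinearMap.ker_eq_bot, LinearMap.ker_eq_bot']
    intro v hv
    refine hH'.eq_zero_of_forms_eq_zero hS fun j hj => ?_
    have := hA j hj v
    rw [hv, map_zero] at this
    exact (mul_eq_zero.1 this.symm).resolve_left (hc j hj)
  exact ⟨LinearEquiv.ofInjectiveEndo A hinj, fun v => rfl⟩

/-- `n + 1` of the units determine `A`. The last one gives a linear identity along `g`, which
extends to all vectors because `g` is nondegenerate. -/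
theorem IsUnitSystem.conclusion_of_card_eq (hs : IsUnitSystem f g H H' h x y)
    (hH : InGeneralPosition H) (hH' : InGeneralPosition H') (hnN : n ≤ N)
    (hg : g.LinearlyNondegenerate) {S : Finset (Fin q)} (hS : S.card = n + 2)
    (hprop : ∀ i ∈ S, ∀ j ∈ S, ∃ κ : ℂ, κ ≠ 0 ∧ ∀ z, h i z = κ * h j z) :
    N = n ∧ ∃ L : (Fin (N + 1) → ℂ) ≃ₗ[ℂ] (Fin (n + 1) → ℂ), f = g.comp L ∧
      ∃ k : Fin (n + 2) → Fin q, Function.Injective k ∧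
        ∀ i, projMap L '' (H' (k i)).points = (H (k i)).points := by
  obtain ⟨s, hsS⟩ : S.Nonempty := Finset.card_pos.1 (by omega)
  choose! c hc using fun i (hi : i ∈ S) => hprop i hi s hsS
  have hc0 : ∀ i ∈ S, c i ≠ 0 := fun i hi => (hc i hi).1
  have hcard : (S.erase s).card = n + 1 := by rw [Finset.card_erase_of_mem hsS]; omega
  have hsub : ∀ j ∈ S.erase s, j ∈ S := fun j => Finset.mem_of_mem_erase
  obtain ⟨A, hA, hAx⟩ := hs.exists_linearMap hH hcard fun j hj => (hc j (hsub j hj)).2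
  have hall : ∀ j ∈ S, ∀ v, (H j).form (A v) = c j * (H' j).form v := by
    intro j hj v
    have h0 : (H j).form ∘ₗ A - c j • (H' j).form = 0 := by
      refine hs.form_eq_zero hg fun z => ?_
      have h1 := hs.form_eq j z
      rw [hAx, map_smul, (hc j hj).2 z, smul_eq_mul] at h1
      simp only [LinearMap.sub_apply, LinearMap.comp_apply, LinearMap.smul_apply, smul_eq_mul]
      apply mul_left_cancel₀ (hs.ne_zero s z)
      linear_combination h1
    have := LinearMap.congr_fun h0 v
    simpa [sub_eq_zero] using this
  -- If `N > n`, the `n + 2` forms `H' j` are independent, yet all are pullbacks by `A` from an `(n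
  -- + 1)`-dimensional dual space.
  obtain rfl : N = n := by
    by_contra hne
    have := hH'.card_le_of_forms_comp_eq A (T := S) (by omega) id c hc0 hall
    omega
  obtain ⟨L, hL⟩ := hH'.exists_linearEquiv hcard (fun j hj => hc0 j (hsub j hj)) hA
  refine ⟨rfl, L, hs.eq_comp (s := s) fun z => by rw [hL, hAx],
    fun i => S.orderEmbOfFin hS i, (S.orderEmbOfFin hS).injective, fun i => ?_⟩
  have hi := S.orderEmbOfFin_mem hS i
  exact projMap_image_points L (hc0 _ hi) fun v => by rw [hL, hall _ hi]

/-- The factor `H' j (y)` can be cancelled on a dense set, and both sides are continuous. In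
contrapositive form, a unit not proportional to `h s` prevents `A` from matching `H j` with `H' j`.
-/
theorem IsUnitSystem.eq_mul_of_form_comp_eq (hs : IsUnitSystem f g H H' h x y)
    (hg : ∀ j, ¬ g.image ⊆ (H' j).points) {s j : Fin q}
    {A : (Fin (N + 1) → ℂ) →ₗ[ℂ] (Fin (n + 1) → ℂ)} (hA : ∀ z, x z = h s z • A (y z)) {c : ℂ}
    (hc : ∀ v, (H j).form (A v) = c * (H' j).form v) (z : Fin m → ℂ) : h j z = c * h s z := by
  by_contra hne
  have hcont : Continuous fun w => h j w - c * h s w :=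
    (hs.differentiable j).continuous.sub (continuous_const.mul (hs.differentiable s).continuous)
  have hev : ∀ᶠ w in 𝓝 z, h j w - c * h s w ≠ 0 :=
    hcont.continuousAt.eventually_ne (sub_ne_zero.2 hne)
  obtain ⟨w, hw1, hw2⟩ := ((hs.frequently_form_ne_zero hg j z).and_eventually hev).exists
  apply hw2
  have h1 := hs.form_eq j w
  rw [hA, map_smul, hc, smul_eq_mul] at h1
  apply mul_right_cancel₀ hw1
  linear_combination -h1

/-- Each relation between `h a` and `h b` becomes an equality of products of two linear forms. Since
`A` matches neither `H a` with `H' a` nor `H b` with `H' b`, unique factorisation leaves only the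
exchange of `a` and `b`. -/
theorem IsUnitSystem.conclusion_of_opposite (hs : IsUnitSystem f g H H' h x y)
    (hH : InGeneralPosition H) (hH' : InGeneralPosition H') (hn : 1 ≤ n) (hnN : n ≤ N)
    (hg' : ∀ j, ¬ g.image ⊆ (H' j).points) {D : ℕ} (hD : 2 ≤ D)
    (hg : g.InNoHypersurfaceOfDegreeLE D) {S : Finset (Fin q)} (hS : S.card = n + 1)
    {s a b : Fin q} (hprop : ∀ i ∈ S, ∃ κ : ℂ, κ ≠ 0 ∧ ∀ z, h i z = κ * h s z)
    (ha : ¬ ∃ κ : ℂ, ∀ z, h a z = κ * h s z) (hb : ¬ ∃ κ : ℂ, ∀ z, h b z = κ * h s z)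
    (hab : a ≠ b) (hrel : (∃ κ : ℂ, κ ≠ 0 ∧ ∀ z, h a z * h b z = κ * h s z ^ 2) ∨
      ∃ κ : ℂ, κ ≠ 0 ∧ ∀ z, h a z = κ * h b z) :
    N = n ∧ ∃ L : (Fin (N + 1) → ℂ) ≃ₗ[ℂ] (Fin (n + 1) → ℂ), f = g.comp L ∧
      ∃ k : Fin (n + 3) → Fin q, Function.Injective k ∧
        (∀ i : Fin (n + 3), (i : ℕ) < n + 1 →
          projMap L '' (H' (k i)).points = (H (k i)).points) ∧
        projMap L '' (H' (k ⟨n + 1, by omega⟩)).points = (H (k ⟨n + 2, by omega⟩)).points ∧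
        projMap L '' (H' (k ⟨n + 2, by omega⟩)).points = (H (k ⟨n + 1, by omega⟩)).points := by
  classical
  choose! c hc using hprop
  obtain ⟨A, hA, hAx⟩ := hs.exists_linearMap hH hS fun j hj => (hc j hj).2
  have hrelx : ∀ j z, h s z * (H j).form (A (y z)) = h j z * (H' j).form (y z) := by
    intro j z
    rw [← hs.form_eq, hAx, map_smul, smul_eq_mul]
  have hna : ¬ ∃ κ : ℂ, ∀ v, ((H a).form ∘ₗ A) v = κ * (H' a).form v := fun ⟨κ, hκ⟩ =>
    ha ⟨κ, hs.eq_mul_of_form_comp_eq hg' hAx hκ⟩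
  have hnb : ¬ ∃ κ : ℂ, ∀ v, ((H b).form ∘ₗ A) v = κ * (H' b).form v := fun ⟨κ, hκ⟩ =>
    hb ⟨κ, hs.eq_mul_of_form_comp_eq hg' hAx hκ⟩
  rcases hrel with ⟨κ, hκ0, hκ⟩ | ⟨κ, hκ0, hκ⟩
  · have hprod : ∀ v, ((H a).form ∘ₗ A) v * ((H b).form ∘ₗ A) v
        = κ * ((H' a).form v * (H' b).form v) := by
      refine hs.form_mul_form_eq hD hg fun z => ?_
      have h1 := hrelx a z
      have h2 := hrelx b z
      simp only [LinearMap.comp_apply]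
      apply mul_left_cancel₀ (pow_ne_zero 2 (hs.ne_zero s z))
      linear_combination h1 * (h s z * (H b).form (A (y z))) + h a z * (H' a).form (y z) * h2
        + (H' a).form (y z) * (H' b).form (y z) * hκ z
    obtain ⟨ca, hca⟩ : ∃ c : ℂ, ∀ v, ((H a).form ∘ₗ A) v = c * (H' b).form v := by
      refine (exists_eq_smul_or_of_forall_eq_zero (v₂ := (H b).form ∘ₗ A)
        fun w hw => ?_).resolve_right hnb
      have := hprod w
      rw [hw, mul_zero, mul_zero] at this
      exact mul_eq_zero.1 this
    obtain ⟨cb, hcb⟩ : ∃ c : ℂ, ∀ v, ((H b).form ∘ₗ A) v = c * (H' a).form v := by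
      refine (exists_eq_smul_or_of_forall_eq_zero (v₁ := (H a).form ∘ₗ A)
        fun w hw => ?_).resolve_left hna
      have := hprod w
      rw [hw, zero_mul, mul_zero] at this
      exact mul_eq_zero.1 this
    have hca0 : ca ≠ 0 := fun h0 => hna ⟨0, fun v => by rw [hca, h0, zero_mul, zero_mul]⟩
    have hcb0 : cb ≠ 0 := fun h0 => hnb ⟨0, fun v => by rw [hcb, h0, zero_mul, zero_mul]⟩
    have haS : a ∉ S := fun h => ha ⟨_, (hc a h).2⟩
    have hbS : b ∉ S := fun h => hb ⟨_, (hc b h).2⟩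
    -- The dimension count uses `S` together with `b`, where `H' b` is the pullback of `H a`, up to
    -- a factor.
    obtain rfl : N = n := by
      by_contra hne
      have hneS : ∀ j ∈ S, j ≠ b := fun j hj h => hbS (h ▸ hj)
      have := hH'.card_le_of_forms_comp_eq (H := H) A (T := insert b S)
        (by rw [Finset.card_insert_of_notMem hbS]; omega) (fun j => if j = b then a else j)
        (fun j => if j = b then ca else c j) (fun j hj => by
          rcases Finset.mem_insert.1 hj with rfl | hj
          · simpa using hca0
          · simpa [hneS j hj] using (hc j hj).1) (fun j hj v => by
          rcases Finset.mem_insert.1 hj with rfl | hj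
          · simpa using hca v
          · simpa [hneS j hj] using hA j hj v)
      rw [Finset.card_insert_of_notMem hbS] at this
      omega
    obtain ⟨L, hL⟩ := hH'.exists_linearEquiv hS (fun j hj => (hc j hj).1) hA
    let k : Fin (N + 3) → Fin q := fun i =>
      if hi : (i : ℕ) < N + 1 then S.orderEmbOfFin hS ⟨i, hi⟩ else if (i : ℕ) = N + 1 then a else b
    have hk1 : ∀ i : Fin (N + 3), (i : ℕ) < N + 1 → k i ∈ S := fun i hi => by
      simp only [k, hi, dif_pos]
      exact S.orderEmbOfFin_mem hS _
    have hka : k ⟨N + 1, by omega⟩ = a := by simp [k]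
    have hkb : k ⟨N + 2, by omega⟩ = b := by simp [k]
    refine ⟨rfl, L, hs.eq_comp (s := s) fun z => by rw [hL, hAx], k, ?_, ?_, ?_, ?_⟩
    · intro i j hij
      simp only [k] at hij
      apply Fin.ext
      have hmem : ∀ i, S.orderEmbOfFin hS i ∈ S := S.orderEmbOfFin_mem hS
      split_ifs at hij with h1 h2 h3 h4 h5 h6 h7
      · simpa using (S.orderEmbOfFin hS).injective hij
      · exact (haS (hij ▸ hmem _)).elim
      · exact (hbS (hij ▸ hmem _)).elim
      · exact (haS (hij ▸ hmem _)).elim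
      · omega
      · exact (hab hij).elim
      · exact (hbS (hij ▸ hmem _)).elim
      · exact (hab hij.symm).elim
      · omega
    · intro i hi
      exact projMap_image_points L (hc _ (hk1 i hi)).1 fun v => by rw [hL, hA _ (hk1 i hi)]
    · rw [hka, hkb]
      exact projMap_image_points L hcb0 fun v => by rw [hL]; exact hcb v
    · rw [hka, hkb]
      exact projMap_image_points L hca0 fun v => by rw [hL]; exact hca v
  -- For proportional `h a` and `h b`, the form `H' b` would divide `H b ∘ A` or `H' a`. The first
  -- is excluded by the choice of `b`, the second by general position.
  · exfalso
    have hprod : ∀ v, ((H a).form ∘ₗ A) v * (H' b).form v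
        = κ * (((H b).form ∘ₗ A) v * (H' a).form v) := by
      refine hs.form_mul_form_eq hD hg fun z => ?_
      have h1 := hrelx a z
      have h2 := hrelx b z
      simp only [LinearMap.comp_apply]
      apply mul_left_cancel₀ (hs.ne_zero s z)
      linear_combination (H' b).form (y z) * h1 - κ * (H' a).form (y z) * h2
        + (H' a).form (y z) * (H' b).form (y z) * hκ z
    obtain ⟨d, hd⟩ : ∃ d : ℂ, ∀ v, (H' a).form v = d * (H' b).form v := by
      refine (exists_eq_smul_or_of_forall_eq_zero (v₁ := (H b).form ∘ₗ A)
        fun w hw => ?_).resolve_left hnb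
      have := hprod w
      rw [hw, mul_zero] at this
      exact mul_eq_zero.1 ((mul_eq_zero.1 this.symm).resolve_left hκ0)
    have hli := hH' {a, b} (by rw [Finset.card_pair hab]; omega)
    have hrel0 := Fintype.linearIndependent_iff.1 hli (fun i => if (i : Fin q) = a then 1 else -d)
      (by
        rw [Finset.sum_coe_sort {a, b}
          (fun i => (if i = a then (1 : ℂ) else -d) • (H' i).form), Finset.sum_pair hab]
        refine LinearMap.ext fun v => ?_
        simp [hab.symm, hd v]) ⟨a, by simp⟩
    simp at hrel0

end UnitSystem

end HyperplaneSharing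

/-! ### The main theorem. -/

theorem mainTheorem7 (m n N q : ℕ) (hn : 1 ≤ n) (hnN : n ≤ N) (hN : 2 * N ≤ 3 * n)
    (H : Fin q → HyperplaneSharing.Hyperplane n) (H' : Fin q → HyperplaneSharing.Hyperplane N)
    (hH : HyperplaneSharing.InGeneralPosition H) (hH' : HyperplaneSharing.InGeneralPosition H')
    (f : HyperplaneSharing.MeromorphicMap m n) (g : HyperplaneSharing.MeromorphicMap m N)
    (hf : ∀ j, ¬ f.image ⊆ (H j).points) (hg : ∀ j, ¬ g.image ⊆ (H' j).points)
    (hfg : ∀ j, f.pullbackDivisor (H j) = g.pullbackDivisor (H' j)) :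
    (g.LinearlyNondegenerate → 3 * n + 2 ≤ q →
      N = n ∧ ∃ L : (Fin (N + 1) → ℂ) ≃ₗ[ℂ] (Fin (n + 1) → ℂ),
        f = g.comp L ∧
        ∃ k : Fin (n + 2) → Fin q, Function.Injective k ∧
          ∀ i, HyperplaneSharing.projMap L '' (H' (k i)).points = (H (k i)).points) ∧
    (g.InNoHypersurfaceOfDegreeLE (N - n + 2) → 3 * n + 1 ≤ q →
      N = n ∧ ∃ L : (Fin (N + 1) → ℂ) ≃ₗ[ℂ] (Fin (n + 1) → ℂ),
        f = g.comp L ∧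
        ((∃ k : Fin (n + 2) → Fin q, Function.Injective k ∧
            ∀ i, HyperplaneSharing.projMap L '' (H' (k i)).points = (H (k i)).points) ∨
          (∃ k : Fin (n + 3) → Fin q, Function.Injective k ∧
            (∀ i : Fin (n + 3), (i : ℕ) < n + 1 →
              HyperplaneSharing.projMap L '' (H' (k i)).points = (H (k i)).points) ∧
            HyperplaneSharing.projMap L '' (H' (k ⟨n + 1, by omega⟩)).points =
              (H (k ⟨n + 2, by omega⟩)).points ∧
            HyperplaneSharing.projMap L '' (H' (k ⟨n + 2, by omega⟩)).points =
              (H (k ⟨n + 1, by omega⟩)).points))) := by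
  by_cases hq : q = 0
  · exact ⟨fun _ h => by omega, fun _ h => by omega⟩
  have i₀ : Fin q := ⟨0, Nat.pos_of_ne_zero hq⟩
  obtain ⟨h, x, y, hs⟩ := HyperplaneSharing.exists_isUnitSystem hg hfg i₀
  obtain ⟨p, hp, hmul, hconst⟩ := hs.exists_weights hH hH' hg i₀
  have hprop : ∀ i j, p i = p j → ∃ κ : ℂ, κ ≠ 0 ∧ ∀ z, h i z = κ * h j z := by
    intro i j hij
    -- Equality of two weights is the case `k = j` of the relation `p i + p j = 2 * p k`; one factor
    -- `h j` cancels.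
    obtain ⟨κ, hκ0, hκ⟩ := hmul i j j (by rw [hij]; ring)
    refine ⟨κ, hκ0, fun z => mul_right_cancel₀ (hs.ne_zero j z) ?_⟩
    rw [hκ]
    ring
  constructor
  · intro hgl hq
    obtain ⟨S, hS, hSp⟩ := hp.exists_card_eq hN hq
    exact hs.conclusion_of_card_eq hH hH' hnN hgl hS fun i hi j hj => hprop i j (hSp i hi j hj)
  · intro hga hq
    rcases hp.exists_card_eq_or hn hnN hN hq with
      ⟨S, hS, hSp⟩ | ⟨S, s₀, a, b, hS, hSp, hab, ha, hb, hrel⟩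
    · obtain ⟨hNn, L, hL, hk⟩ := hs.conclusion_of_card_eq hH hH' hnN
        (hga.linearlyNondegenerate (by omega)) hS fun i hi j hj => hprop i j (hSp i hi j hj)
      exact ⟨hNn, L, hL, Or.inl hk⟩
    · obtain ⟨s, hsS⟩ : S.Nonempty := Finset.card_pos.1 (by omega)
      have hps : p s = s₀ := hSp s hsS
      -- Only the absence of hypersurfaces of degrees one and two is needed in this part.
      obtain ⟨hNn, L, hL, hk⟩ := hs.conclusion_of_opposite hH hH' hn hnN hg
        (by omega : 2 ≤ N - n + 2) hga hS (s := s) (a := a) (b := b)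
        (fun i hi => hprop i s ((hSp i hi).trans hps.symm))
        (fun hκ => ha ((hconst a s hκ).trans hps)) (fun hκ => hb ((hconst b s hκ).trans hps)) hab
        (hrel.imp (fun h => hmul a b s (by rw [h, hps])) fun h => hprop a b h)
      exact ⟨hNn, L, hL, Or.inr hk⟩
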